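/- **Theorem (Zinno).** Let $n\ge 0$ be an integer and let $\tau,t\in\mathbb C\setminus\{0\}$ satisfy $\tau^{-1}=2+t+t^{-1}$. Let $TL_n$ be the unital associative $\mathbb C$-algebra with generators $e_1,\dots,e_{n-1}$ and relations $e_ie_j=e_je_i$ for $|i-j|\ge 2$, $e_i^2=e_i$, and $e_ie_{i\pm1}e_i=\tau e_i$; put $h_i=(t+1)e_i-1$. Let $B_n$ be the braid group, with Artin generators $\sigma_1,\dots,\sigma_{n-1}$ and relations $\sigma_i\sigma_j=\sigma_j\sigma_i$ for $|i-j|\ge2$, $\sigma_i\sigma_{i+1}\sigma_i=\sigma_{i+1}\sigma_i\sigma_{i+1}$, and let $\pi:B_n\to TL_n$ be the multiplicative homomorphism with $\pi(\sigma_i)=h_i$ (each $h_i$ is invertible in $TL_n$). For $1\le i<j\le n$ let $$a_{ji}=\sigma_{j-1}\sigma_{j-2}\cdots\sigma_{i+1}\,\sigma_i\,\sigma_{i+1}^{-1}\cdots\sigma_{j-2}^{-1}\sigma_{j-1}^{-1}\in B_n,$$ and let $P_k=\exp(-2k\pi \sqrt{-1}/n)\in\mathbb C$ for $1\le k\le n$.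 For indices $n\ge i_1>i_2>\cdots>i_k\ge 1$ with $k\ge1$, the descending cycle $[i_1,\dots,i_k]$ is the element $a_{i_1i_2}a_{i_2i_3}\cdots a_{i_{k-1}i_k}$ of $B_n$ (the identity if $k=1$). Two descending cycles $[i_1,\dots,i_k]$ and $[j_1,\dots,j_l]$ are parallel if the convex hulls of $\{P_{i_1},\dots,P_{i_k}\}$ and $\{P_{j_1},\dots,P_{j_l}\}$ are disjoint. The simple elements of $B_n$ (for the dual, or Birman–Ko–Lee, presentation) are the finite products of pairwise parallel descending cycles. A partition of $\{1,\dots,n\}$ is non-crossing if the convex hulls of the sets $\{P_k : k\in S\}$, for $S$ running over its blocks, are pairwise disjoint. Then: 1. Sending a non-crossing partition of $\{1,\dots,n\}$ to the product of the descending cycles of its blocks, taken in increasing order of the largest elements of the blocks, is a bijection from the set of non-crossing partitions of $\{1,\dots,n\}$ onto the set of simple elements of $B_n$. 2. The images $\pi(b)$ of the simple elements $b$ of $B_n$ form a basis of the $\mathbb C$-vector space $TL_n$: the family $(\pi(b))$, indexed by the simple elements $b$, is linearly independent and spans $TL_n$. -/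

import Mathlib

noncomputable section

namespace Zinno

/-- The defining relators of Artin's presentation of the braid group on `n` strands, in the free
group on the letters `σ₁, …, σₙ₋₁`. -/
inductive BraidRel (n : ℕ) : FreeGroup (Set.Ico 1 n) → Prop
  | comm (i j : Set.Ico 1 n) (h : 2 ≤ |((i : ℕ) : ℤ) - ((j : ℕ) : ℤ)|) :
      BraidRel n (FreeGroup.of i * FreeGroup.of j * (FreeGroup.of j * FreeGroup.of i)⁻¹)
  | braid (i j : Set.Ico 1 n) (h : (j : ℕ) = (i : ℕ) + 1) :
      BraidRel n (FreeGroup.of i * FreeGroup.of j * FreeGroup.of i *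
        (FreeGroup.of j * FreeGroup.of i * FreeGroup.of j)⁻¹)

/-- The braid group `Bₙ`, by Artin's presentation. -/
abbrev BraidGroup (n : ℕ) : Type := PresentedGroup {r | BraidRel n r}

/-- The Artin generator `σₖ` of `Bₙ`, `1 ≤ k ≤ n - 1` (and `1` for every other `k`, a value that
is never used). -/
def sigma (n k : ℕ) : BraidGroup n :=
  if h : k ∈ Set.Ico 1 n then PresentedGroup.of ⟨k, h⟩ else 1

/-- The defining relations of the Temperley-Lieb algebra, in the free algebra on the letters
`e₁, …, eₙ₋₁`. -/
inductive TLRel (n : ℕ) (τ : ℂ) :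
    FreeAlgebra ℂ (Set.Ico 1 n) → FreeAlgebra ℂ (Set.Ico 1 n) → Prop
  | comm (i j : Set.Ico 1 n) (h : 2 ≤ |((i : ℕ) : ℤ) - ((j : ℕ) : ℤ)|) :
      TLRel n τ (FreeAlgebra.ι ℂ i * FreeAlgebra.ι ℂ j) (FreeAlgebra.ι ℂ j * FreeAlgebra.ι ℂ i)
  | idem (i : Set.Ico 1 n) :
      TLRel n τ (FreeAlgebra.ι ℂ i * FreeAlgebra.ι ℂ i) (FreeAlgebra.ι ℂ i)
  | up (i j : Set.Ico 1 n) (h : (j : ℕ) = (i : ℕ) + 1) :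
      TLRel n τ (FreeAlgebra.ι ℂ i * FreeAlgebra.ι ℂ j * FreeAlgebra.ι ℂ i)
        (τ • FreeAlgebra.ι ℂ i)
  | down (i j : Set.Ico 1 n) (h : (i : ℕ) = (j : ℕ) + 1) :
      TLRel n τ (FreeAlgebra.ι ℂ i * FreeAlgebra.ι ℂ j * FreeAlgebra.ι ℂ i)
        (τ • FreeAlgebra.ι ℂ i)

/-- The Temperley-Lieb algebra `TLₙ` over `ℂ` with parameter `τ`, in the generators
`e₁, …, eₙ₋₁`. -/
abbrev TL (n : ℕ) (τ : ℂ) : Type := RingQuot (TLRel n τ)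

/-- The generator `eᵢ` of `TLₙ`. -/
def e (n : ℕ) (τ : ℂ) (i : Set.Ico 1 n) : TL n τ :=
  RingQuot.mkAlgHom ℂ (TLRel n τ) (FreeAlgebra.ι ℂ i)

/-- The element `hᵢ = (t + 1) eᵢ - 1` of `TLₙ`. -/
def h (n : ℕ) (τ t : ℂ) (i : Set.Ico 1 n) : TL n τ :=
  (t + 1) • e n τ i - 1

theorem e_comm {n : ℕ} {τ : ℂ} (i j : Set.Ico 1 n)
    (hij : 2 ≤ |((i : ℕ) : ℤ) - ((j : ℕ) : ℤ)|) :
    e n τ i * e n τ j = e n τ j * e n τ i := by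
  simpa [e] using RingQuot.mkAlgHom_rel ℂ (TLRel.comm (τ := τ) i j hij)

theorem e_idem {n : ℕ} {τ : ℂ} (i : Set.Ico 1 n) : e n τ i * e n τ i = e n τ i := by
  simpa [e] using RingQuot.mkAlgHom_rel ℂ (TLRel.idem (τ := τ) i)

theorem e_up {n : ℕ} {τ : ℂ} (i j : Set.Ico 1 n) (hij : (j : ℕ) = (i : ℕ) + 1) :
    e n τ i * e n τ j * e n τ i = τ • e n τ i := by
  simpa [e] using RingQuot.mkAlgHom_rel ℂ (TLRel.up (τ := τ) i j hij)

theorem e_down {n : ℕ} {τ : ℂ} (i j : Set.Ico 1 n) (hij : (i : ℕ) = (j : ℕ) + 1) :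
    e n τ i * e n τ j * e n τ i = τ • e n τ i := by
  simpa [e] using RingQuot.mkAlgHom_rel ℂ (TLRel.down (τ := τ) i j hij)

theorem h_sq {n : ℕ} {τ t : ℂ} (i : Set.Ico 1 n) :
    h n τ t i * h n τ t i = (t - 1) • h n τ t i + t • (1 : TL n τ) := by
  simp only [h, sub_mul, mul_sub, smul_mul_assoc, mul_smul_comm, e_idem, one_mul, mul_one]
  module

theorem h_comm {n : ℕ} {τ t : ℂ} (i j : Set.Ico 1 n)
    (hij : 2 ≤ |((i : ℕ) : ℤ) - ((j : ℕ) : ℤ)|) :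
    h n τ t i * h n τ t j = h n τ t j * h n τ t i := by
  simp only [h, sub_mul, mul_sub, smul_mul_assoc, mul_smul_comm, e_comm i j hij, one_mul, mul_one]
  module

theorem sq_mul_tau {τ t : ℂ} (hτ : τ ≠ 0) (ht : t ≠ 0) (hτt : τ⁻¹ = 2 + t + t⁻¹) :
    (t + 1) ^ 2 * τ = t := by
  field_simp at hτt
  linear_combination -hτt

theorem h_braid {n : ℕ} {τ t : ℂ} (hτ : τ ≠ 0) (ht : t ≠ 0) (hτt : τ⁻¹ = 2 + t + t⁻¹)
    (i j : Set.Ico 1 n) (hij : (j : ℕ) = (i : ℕ) + 1) :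
    h n τ t i * h n τ t j * h n τ t i = h n τ t j * h n τ t i * h n τ t j := by
  have key := sq_mul_tau hτ ht hτt
  simp only [h, sub_mul, mul_sub, smul_mul_assoc, mul_smul_comm, e_idem, e_up i j hij,
    e_down j i hij, one_mul, mul_one]
  match_scalars <;> first
    | linear_combination (t + 1) * key
    | linear_combination -(t + 1) * key
    | ring1

/-- `hᵢ` as a unit of `TLₙ`, with inverse `t⁻¹ (hᵢ - (t - 1))`. -/
def hUnit (n : ℕ) (τ t : ℂ) (ht : t ≠ 0) (i : Set.Ico 1 n) : (TL n τ)ˣ where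
  val := h n τ t i
  inv := t⁻¹ • (h n τ t i - (t - 1) • (1 : TL n τ))
  val_inv := by
    rw [mul_smul_comm, mul_sub, h_sq, mul_smul_comm, mul_one, add_sub_cancel_left, smul_smul,
      inv_mul_cancel₀ ht, one_smul]
  inv_val := by
    rw [smul_mul_assoc, sub_mul, h_sq, smul_mul_assoc, one_mul, add_sub_cancel_left, smul_smul,
      inv_mul_cancel₀ ht, one_smul]

/-- The homomorphism `π : Bₙ → TLₙ` (into the multiplicative monoid of `TLₙ`) that sends `σᵢ`
to `hᵢ`. -/
def braidToTL (n : ℕ) (τ t : ℂ) (hτ : τ ≠ 0) (ht : t ≠ 0) (hτt : τ⁻¹ = 2 + t + t⁻¹) :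
    BraidGroup n →* TL n τ :=
  (Units.coeHom (TL n τ)).comp <|
    PresentedGroup.toGroup (f := hUnit n τ t ht) <| by
      rintro r (⟨i, j, hij⟩ | ⟨i, j, hij⟩)
      · simp only [map_mul, map_inv, FreeGroup.lift_apply_of]
        rw [mul_inv_eq_one]
        exact Units.ext (h_comm i j hij)
      · simp only [map_mul, map_inv, FreeGroup.lift_apply_of]
        rw [mul_inv_eq_one]
        exact Units.ext (h_braid hτ ht hτt i j hij)

theorem braidToTL_sigma (n : ℕ) (τ t : ℂ) (hτ : τ ≠ 0) (ht : t ≠ 0) (hτt : τ⁻¹ = 2 + t + t⁻¹)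
    (i : Set.Ico 1 n) : braidToTL n τ t hτ ht hτt (sigma n i) = h n τ t i := by
  simp [braidToTL, sigma, hUnit, -Set.mem_Ico]

/-- For `1 ≤ i < j ≤ n`, the generator
`aⱼᵢ = σⱼ₋₁ σⱼ₋₂ ⋯ σᵢ₊₁ σᵢ σᵢ₊₁⁻¹ ⋯ σⱼ₋₂⁻¹ σⱼ₋₁⁻¹` of the dual presentation of `Bₙ`. -/
def band (n j i : ℕ) : BraidGroup n :=
  ((List.Ico (i + 1) j).reverse.map (sigma n)).prod * sigma n i *
    ((List.Ico (i + 1) j).reverse.map (sigma n)).prod⁻¹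

/-- The product `a_{i₁i₂} a_{i₂i₃} ⋯ a_{iₖ₋₁iₖ}` attached to a list `i₁, i₂, …, iₖ`; it is `1` for
lists of length at most one. -/
def cycleProd (n : ℕ) : List ℕ → BraidGroup n
  | [] => 1
  | [_] => 1
  | i :: j :: l => band n i j * cycleProd n (j :: l)

/-- The descending cycle `[i₁, i₂, …, iₖ]` on the set of indices `s = {i₁ > i₂ > ⋯ > iₖ}`. -/
def descCycle (n : ℕ) (s : Finset ℕ) : BraidGroup n :=
  cycleProd n (s.sort (· ≥ ·))

/-- The point `Pₖ = exp (-2kπi/n)` of the unit circle. -/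
def point (n k : ℕ) : ℂ :=
  Complex.exp (-((2 * (k : ℂ) * (Real.pi : ℂ) / (n : ℂ)) * Complex.I))

/-- Two sets of indices are parallel if the convex hulls of the corresponding sets of points are
disjoint. -/
def Parallel (n : ℕ) (s u : Finset ℕ) : Prop :=
  Disjoint (convexHull ℝ (point n '' (s : Set ℕ))) (convexHull ℝ (point n '' (u : Set ℕ)))

/-- The simple elements of `Bₙ` (for the dual presentation): the products of pairwise parallel
descending cycles. -/
def simpleElements (n : ℕ) : Set (BraidGroup n) :=
  {b | ∃ l : List (Finset ℕ), (∀ s ∈ l, s.Nonempty ∧ s ⊆ Finset.Icc 1 n) ∧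
    l.Pairwise (Parallel n) ∧ b = (l.map (descCycle n)).prod}

/-- A partition of `{1, …, n}`, i.e. of `{P₁, …, Pₙ}`, is non-crossing if the convex hulls of its
blocks are pairwise disjoint. -/
def IsNonCrossing {n : ℕ} (P : Finpartition (Finset.Icc 1 n)) : Prop :=
  (P.parts : Set (Finset ℕ)).Pairwise (Parallel n)

/-- The product of the descending cycles of the blocks of a partition of `{1, …, n}`. Every block
contributes one factor, at the place of its largest element. -/
def partitionElement (n : ℕ) (P : Finpartition (Finset.Icc 1 n)) : BraidGroup n :=
  ((List.Ico 1 (n + 1)).map fun k =>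
    if ∀ m ∈ P.part k, m ≤ k then descCycle n (P.part k) else 1).prod

end Zinno

end

/-!
Both halves of the theorem come from one linear algebra statement: the elements `π(b_P)`, for `P` a
non-crossing partition with product of cycles `b_P`, are linearly independent and span `TLₙ`. Linear
independence also makes `P ↦ b_P` injective; surjectivity onto the simple elements holds because
cycles on non-crossing sets commute and cycles on singletons are trivial. Throughout,
disjointness of convex hulls is replaced by the combinatorial condition `NonCross`
(`NonCross.parallel`, `Parallel.nonCross`).

*Spanning.* The dual generators satisfy `a_{ts} a_{sr} = a_{tr} a_{ts} = a_{sr} a_{tr}`, and in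
`TLₙ` the product `a_{sr} a_{ts}` is a linear combination of `1`, `a_{ts}`, `a_{sr}`, `a_{tr}` and
`a_{ts} a_{sr}` (`IsTLHom.flip_band`). Let `T(a, b)` be the algebra of the strands `a, …, b`. By
induction on `b - a` one shows
`T(a, b) = T(a, b - 1) + ∑ₖ a_{bk} T(a, k) T(k + 1, b - 1)`, where the right-hand side contains `1`
and is a right ideal by the relations above (`IsTLHom.mem_span_arcSet`). This is the recursion of
the non-crossing partitions according to the neighbour `k` of `b` in its block, which yields
`span_simpleElements`.

*Independence.* The algebra `TLₙ` acts on functions on `0-1`-states of the sites `1, …, n`. Call the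
degree of a state the sum of its occupied positions. The element `a_{ji}` raises the degree by at
most `j - i`, and its part of degree exactly `j - i` moves a particle from `i` to an empty site `j`,
whatever lies in between (`exists_hasTop_band`). So the top degree part of `b_P` takes the indicator
of the non-maximal elements of the blocks of `P` to the indicator of the non-minimal ones, and a
state with a non-zero top entry contains all these non-maximal elements. Since a non-crossing
partition is determined by these two sets (`IsNonCrossing.eq_of_hasAbove_iff`), testing on the
corresponding matrix entries gives a triangular system with non-zero diagonal
(`linearIndependent_of_hasTop`). No genericity of `t` is needed.
-/

noncomputable section

namespace Zinno

/-! ### Non-crossing sets and disjoint convex hulls -/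

/-- Two finite sets of indices are non-crossing if they are disjoint and no two elements of one of
them alternate with two elements of the other. -/
def NonCross (s u : Finset ℕ) : Prop :=
  Disjoint s u ∧ (∀ a ∈ s, ∀ b ∈ u, ∀ c ∈ s, ∀ d ∈ u, a < b → b < c → ¬ c < d) ∧
    ∀ a ∈ u, ∀ b ∈ s, ∀ c ∈ u, ∀ d ∈ s, a < b → b < c → ¬ c < d

theorem NonCross.symm {s u : Finset ℕ} (hsu : NonCross s u) : NonCross u s :=
  ⟨hsu.1.symm, hsu.2.2, hsu.2.1⟩

theorem Parallel.symm {n : ℕ} {s u : Finset ℕ} (hsu : Parallel n s u) : Parallel n u s :=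
  Disjoint.symm hsu

/-- The angle of the point `Pₖ`, measured clockwise from `1`. -/
def angle (n k : ℕ) : ℝ := 2 * k * Real.pi / n

theorem point_eq (n k : ℕ) : point n k = ⟨Real.cos (angle n k), -Real.sin (angle n k)⟩ := by
  have : point n k = Complex.exp (((-angle n k : ℝ) : ℂ) * Complex.I) := by
    rw [point, angle]; push_cast; congr 1; ring
  rw [this]
  apply Complex.ext
  · rw [Complex.exp_ofReal_mul_I_re, Real.cos_neg]
  · rw [Complex.exp_ofReal_mul_I_im, Real.sin_neg]

/-- The points of the unit circle at angular distance more than `δ` from a given direction lie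
strictly on the far side of the chord between the two points at angular distance `δ`. -/
theorem cos_lt_cos_of_between {δ x : ℝ} (hδ : 0 ≤ δ) (h1 : δ < |x|) (h2 : |x| < 2 * Real.pi - δ) :
    Real.cos x < Real.cos δ := by
  rw [← Real.cos_abs x]
  rcases le_total |x| Real.pi with hx | hx
  · exact Real.cos_lt_cos_of_nonneg_of_le_pi hδ hx h1
  · rw [← Real.cos_two_pi_sub |x|]
    exact Real.cos_lt_cos_of_nonneg_of_le_pi hδ (by linarith) (by linarith)

/-- The chord from `P_p` to `P_q` separates the indices in `[p, q]` from the other ones. -/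
theorem parallel_of_arc {n p q : ℕ} {s u : Finset ℕ} (hp : 1 ≤ p) (hpq : p ≤ q) (hq : q ≤ n)
    (hu : ∀ x ∈ u, p ≤ x ∧ x ≤ q) (hs : ∀ x ∈ s, 1 ≤ x ∧ x ≤ n ∧ (x < p ∨ q < x)) :
    Parallel n s u := by
  have hn : (0 : ℝ) < n := by exact_mod_cast (by omega : 0 < n)
  have hπ := Real.pi_pos
  set μ : ℝ := (p + q) * Real.pi / n with hμ
  set δ : ℝ := (q - p) * Real.pi / n with hδ
  set f : ℂ → ℝ := fun z => z.re * Real.cos μ - z.im * Real.sin μ with hf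
  have hlin : IsLinearMap ℝ f :=
    ⟨fun x y => by simp only [hf, Complex.add_re, Complex.add_im]; ring,
      fun c x => by simp [hf]; ring⟩
  have hfp : ∀ k, f (point n k) = Real.cos (angle n k - μ) := fun k => by
    rw [point_eq, Real.cos_sub]; simp only [hf]; ring
  have hpq' : (p : ℝ) ≤ q := by exact_mod_cast hpq
  have hp' : (1 : ℝ) ≤ p := by exact_mod_cast hp
  have hq' : (q : ℝ) ≤ n := by exact_mod_cast hq
  have hle {x y : ℝ} (hxy : x ≤ y) : x * Real.pi / n ≤ y * Real.pi / n :=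
    div_le_div_of_nonneg_right (mul_le_mul_of_nonneg_right hxy hπ.le) hn.le
  have hlt {x y : ℝ} (hxy : x < y) : x * Real.pi / n < y * Real.pi / n :=
    div_lt_div_of_pos_right (mul_lt_mul_of_pos_right hxy hπ) hn
  have hδ0 : 0 ≤ δ := by
    rw [hδ]; exact div_nonneg (mul_nonneg (by linarith) hπ.le) hn.le
  have hδπ : δ ≤ Real.pi := by
    rw [hδ, div_le_iff₀ hn]; nlinarith
  have hang : ∀ k, angle n k - μ = (2 * k - p - q) * Real.pi / n := fun k => by
    rw [angle, hμ]; ring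
  have h2π : 2 * Real.pi - δ = (2 * n - q + p) * Real.pi / n := by
    rw [hδ]; field_simp; ring
  have hA : convexHull ℝ (point n '' (u : Set ℕ)) ⊆ {z | Real.cos δ ≤ f z} := by
    refine convexHull_min ?_ (convex_halfSpace_ge hlin _)
    rintro _ ⟨k, hk, rfl⟩
    obtain ⟨h1, h2⟩ := hu k hk
    have h1' : (p : ℝ) ≤ k := by exact_mod_cast h1
    have h2' : (k : ℝ) ≤ q := by exact_mod_cast h2
    rw [Set.mem_ofPred_eq, hfp, ← Real.cos_abs (angle n k - μ)]
    refine Real.cos_le_cos_of_nonneg_of_le_pi (abs_nonneg _) hδπ ?_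
    rw [hang, hδ, abs_le, ← neg_div, ← neg_mul]
    exact ⟨hle (by linarith), hle (by linarith)⟩
  have hB : convexHull ℝ (point n '' (s : Set ℕ)) ⊆ {z | f z < Real.cos δ} := by
    refine convexHull_min ?_ (convex_halfSpace_lt hlin _)
    rintro _ ⟨k, hk, rfl⟩
    obtain ⟨h1, h2, h3⟩ := hs k hk
    have h1' : (1 : ℝ) ≤ k := by exact_mod_cast h1
    have h2' : (k : ℝ) ≤ n := by exact_mod_cast h2
    rw [Set.mem_ofPred_eq, hfp]
    refine cos_lt_cos_of_between hδ0 ?_ ?_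
    · rw [hang, hδ, lt_abs]
      rcases h3 with h3 | h3
      · right
        have : (k : ℝ) < p := by exact_mod_cast h3
        rw [← neg_div, ← neg_mul]; exact hlt (by linarith)
      · left
        have : (q : ℝ) < k := by exact_mod_cast h3
        exact hlt (by linarith)
    · rw [hang, h2π, abs_lt, ← neg_div, ← neg_mul]
      rcases h3 with h3 | h3
      · have : (k : ℝ) < p := by exact_mod_cast h3
        exact ⟨hlt (by linarith), hlt (by linarith)⟩
      · have : (q : ℝ) < k := by exact_mod_cast h3
        exact ⟨hlt (by linarith), hlt (by linarith)⟩
  rw [Parallel, Set.disjoint_left]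
  intro z hz hz'
  have h1 : Real.cos δ ≤ f z := hA hz'
  have h2 : f z < Real.cos δ := hB hz
  linarith

/-- The set that does not contain the smallest index lies in an arc that avoids the other set. -/
theorem NonCross.parallel {n : ℕ} {s u : Finset ℕ} (hsu : NonCross s u) (hs : s.Nonempty)
    (hu : u.Nonempty) (hsn : s ⊆ Finset.Icc 1 n) (hun : u ⊆ Finset.Icc 1 n) : Parallel n s u := by
  wlog hmin : s.min' hs < u.min' hu generalizing s u
  · refine (this hsu.symm hu hs hun hsn (lt_of_le_of_ne (not_lt.1 hmin) fun heq => ?_)).symm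
    exact Finset.disjoint_left.1 hsu.1 (s.min'_mem hs) (heq ▸ u.min'_mem hu)
  have hp := Finset.mem_Icc.1 (hun (u.min'_mem hu))
  have hq := Finset.mem_Icc.1 (hun (u.max'_mem hu))
  refine parallel_of_arc hp.1 (u.min'_le _ (u.max'_mem hu)) hq.2
    (fun x hx => ⟨u.min'_le x hx, u.le_max' x hx⟩) fun x hx => ?_
  have hx' := Finset.mem_Icc.1 (hsn hx)
  refine ⟨hx'.1, hx'.2, ?_⟩
  by_contra! hcon
  have hne : ∀ y ∈ u, x ≠ y := fun y hy hxy => Finset.disjoint_left.1 hsu.1 hx (hxy ▸ hy)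
  exact hsu.2.1 _ (s.min'_mem hs) _ (u.min'_mem hu) x hx _ (u.max'_mem hu) hmin
    (lt_of_le_of_ne hcon.1 (hne _ (u.min'_mem hu)).symm)
    (lt_of_le_of_ne hcon.2 (hne _ (u.max'_mem hu)))

/-- Twice the area of a triangle inscribed in the unit circle is positive. -/
theorem inscribed_area_pos {α β γ : ℝ} (h1 : α < β) (h2 : β < γ) (h3 : γ < α + 2 * Real.pi) :
    0 < Real.sin (β - α) + Real.sin (γ - β) - Real.sin (γ - α) := by
  have key : ∀ p q : ℝ, Real.sin (2 * p) + Real.sin (2 * q) - Real.sin (2 * (p + q)) =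
      4 * Real.sin p * Real.sin q * Real.sin (p + q) := fun p q => by
    rw [Real.sin_two_mul, Real.sin_two_mul, Real.sin_two_mul, Real.sin_add, Real.cos_add]
    linear_combination (-2 * Real.sin p * Real.cos p) * Real.sin_sq_add_cos_sq q
      + (-2 * Real.sin q * Real.cos q) * Real.sin_sq_add_cos_sq p
  have h := key ((β - α) / 2) ((γ - β) / 2)
  rw [show 2 * ((β - α) / 2) = β - α by ring, show 2 * ((γ - β) / 2) = γ - β by ring,
    show 2 * ((β - α) / 2 + (γ - β) / 2) = γ - α by ring] at h
  rw [h]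
  have s1 := Real.sin_pos_of_pos_of_lt_pi (x := (β - α) / 2) (by linarith) (by linarith)
  have s2 := Real.sin_pos_of_pos_of_lt_pi (x := (γ - β) / 2) (by linarith) (by linarith)
  have s3 := Real.sin_pos_of_pos_of_lt_pi (x := (β - α) / 2 + (γ - β) / 2) (by linarith)
    (by linarith)
  positivity

theorem angle_lt {n j k : ℕ} (hn : 0 < n) (hjk : j < k) : angle n j < angle n k := by
  have : (j : ℝ) < k := by exact_mod_cast hjk
  have : (0 : ℝ) < n := by exact_mod_cast hn
  unfold angle; gcongr

/-- Two chords of the unit circle whose end points alternate meet: the four areas of the triangles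
formed by their end points are the coefficients of an affine dependence. -/
theorem not_parallel_of_lt {n a b c d : ℕ} {s u : Finset ℕ} (ha : a ∈ s) (hb : b ∈ u) (hc : c ∈ s)
    (hd : d ∈ u) (hab : a < b) (hbc : b < c) (hcd : c < d) (h1 : 1 ≤ a) (hdn : d ≤ n) :
    ¬ Parallel n s u := by
  have hn : 0 < n := by omega
  have hd2 : angle n d < angle n a + 2 * Real.pi := by
    have h0 : (0 : ℝ) < n := by exact_mod_cast hn
    have h1' : (1 : ℝ) ≤ a := by exact_mod_cast h1
    have hdn' : (d : ℝ) ≤ n := by exact_mod_cast hdn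
    rw [angle, angle, show 2 * (a : ℝ) * Real.pi / n + 2 * Real.pi = 2 * (a + n) * Real.pi / n by
      field_simp]
    have := Real.pi_pos
    gcongr
    linarith
  have lab := angle_lt hn hab
  have lbc := angle_lt hn hbc
  have lcd := angle_lt hn hcd
  have pA := inscribed_area_pos lbc lcd (by linarith)
  have pB := inscribed_area_pos (lab.trans lbc) lcd (by linarith)
  have pC := inscribed_area_pos lab (lbc.trans lcd) (by linarith)
  have pD := inscribed_area_pos lab lbc (by linarith)
  generalize hA : Real.sin (angle n c - angle n b) + Real.sin (angle n d - angle n c)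
    - Real.sin (angle n d - angle n b) = A at pA
  generalize hB : Real.sin (angle n c - angle n a) + Real.sin (angle n d - angle n c)
    - Real.sin (angle n d - angle n a) = B at pB
  generalize hC : Real.sin (angle n b - angle n a) + Real.sin (angle n d - angle n b)
    - Real.sin (angle n d - angle n a) = C at pC
  generalize hD : Real.sin (angle n b - angle n a) + Real.sin (angle n c - angle n b)
    - Real.sin (angle n c - angle n a) = D at pD
  have hsum : A + C = B + D := by rw [← hA, ← hB, ← hC, ← hD]; ring
  simp only [Real.sin_sub] at hA hB hC hD
  have hpt : A • point n a + C • point n c = B • point n b + D • point n d := by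
    simp only [point_eq, ← hA, ← hB, ← hC, ← hD]
    apply Complex.ext <;> simp only [Complex.add_re, Complex.add_im, Complex.smul_re,
      Complex.smul_im, smul_eq_mul] <;> ring
  intro hpar
  have m1 : (A + C)⁻¹ • (A • point n a + C • point n c) ∈
      convexHull ℝ (point n '' (s : Set ℕ)) := by
    have := (convex_convexHull ℝ (point n '' (s : Set ℕ))) (x := point n a) (y := point n c)
      (subset_convexHull ℝ _ ⟨a, ha, rfl⟩) (subset_convexHull ℝ _ ⟨c, hc, rfl⟩)
      (a := (A + C)⁻¹ * A) (b := (A + C)⁻¹ * C) (by positivity) (by positivity) (by field_simp)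
    simpa [smul_add, mul_smul] using this
  have m2 : (A + C)⁻¹ • (A • point n a + C • point n c) ∈
      convexHull ℝ (point n '' (u : Set ℕ)) := by
    have := (convex_convexHull ℝ (point n '' (u : Set ℕ))) (x := point n b) (y := point n d)
      (subset_convexHull ℝ _ ⟨b, hb, rfl⟩) (subset_convexHull ℝ _ ⟨d, hd, rfl⟩)
      (a := (B + D)⁻¹ * B) (b := (B + D)⁻¹ * D) (by positivity) (by positivity) (by field_simp)
    rw [hpt, hsum]
    simpa [smul_add, mul_smul] using this
  exact Set.disjoint_left.1 hpar m1 m2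

theorem Parallel.nonCross {n : ℕ} {s u : Finset ℕ} (hsu : Parallel n s u)
    (hsn : s ⊆ Finset.Icc 1 n) (hun : u ⊆ Finset.Icc 1 n) : NonCross s u := by
  refine ⟨Finset.disjoint_left.2 fun x hx hx' => Set.disjoint_left.1 hsu
    (subset_convexHull ℝ _ ⟨x, hx, rfl⟩) (subset_convexHull ℝ _ ⟨x, hx', rfl⟩), ?_, ?_⟩
  · intro a ha b hb c hc d hd hab hbc hcd
    exact not_parallel_of_lt ha hb hc hd hab hbc hcd (Finset.mem_Icc.1 (hsn ha)).1
      (Finset.mem_Icc.1 (hun hd)).2 hsu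
  · intro a ha b hb c hc d hd hab hbc hcd
    exact not_parallel_of_lt ha hb hc hd hab hbc hcd (Finset.mem_Icc.1 (hun ha)).1
      (Finset.mem_Icc.1 (hsn hd)).2 hsu.symm

/-! ### The dual generators of the braid group -/

theorem sigma_comm (n : ℕ) {i j : ℕ} (hij : i + 2 ≤ j ∨ j + 2 ≤ i) :
    Commute (sigma n i) (sigma n j) := by
  unfold sigma
  split_ifs with hi hj
  · have := PresentedGroup.one_of_mem (rels := {r | BraidRel n r})
      (BraidRel.comm ⟨i, hi⟩ ⟨j, hj⟩ (by simp only [le_abs]; omega))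
    rw [map_mul, map_inv, mul_inv_eq_one] at this
    simpa [Commute, SemiconjBy, PresentedGroup.of] using this
  all_goals simp

theorem sigma_braid {n i : ℕ} (hi : 1 ≤ i) (hin : i + 1 < n) :
    sigma n i * sigma n (i + 1) * sigma n i = sigma n (i + 1) * sigma n i * sigma n (i + 1) := by
  have hi' : i ∈ Set.Ico 1 n := ⟨hi, by omega⟩
  have hj' : i + 1 ∈ Set.Ico 1 n := ⟨by omega, hin⟩
  rw [sigma, dif_pos hi', sigma, dif_pos hj']
  have := PresentedGroup.one_of_mem (rels := {r | BraidRel n r})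
    (BraidRel.braid ⟨i, hi'⟩ ⟨i + 1, hj'⟩ rfl)
  rw [map_mul, map_inv, mul_inv_eq_one] at this
  simpa [PresentedGroup.of] using this

theorem band_succ_self (n i : ℕ) : band n (i + 1) i = sigma n i := by
  simp [band]

theorem band_succ {n i j : ℕ} (hij : i < j) :
    band n (j + 1) i = sigma n j * band n j i * (sigma n j)⁻¹ := by
  simp only [band, List.Ico.succ_top (show i + 1 ≤ j from hij), List.reverse_append,
    List.map_append, List.reverse_singleton, List.map_singleton, List.prod_append,
    List.prod_singleton]
  group

/-- `a_{ji}` lies in the subgroup generated by `σᵢ, …, σⱼ₋₁`. -/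
theorem commute_band {n i j : ℕ} {g : BraidGroup n} (hij : i < j)
    (hg : ∀ m, i ≤ m → m < j → Commute g (sigma n m)) : Commute g (band n j i) := by
  induction j, hij using Nat.le_induction with
  | base => rw [band_succ_self]; exact hg i le_rfl (by omega)
  | succ j hij ih =>
    rw [band_succ hij]
    have hj := hg j (by omega) (by omega)
    exact (hj.mul_right (ih fun m h1 h2 => hg m h1 (by omega))).mul_right hj.inv_right

theorem sigma_commute_band_of_lt {n m i j : ℕ} (hij : i < j) (hm : m + 1 < i ∨ j < m) :
    Commute (sigma n m) (band n j i) :=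
  commute_band hij fun _ _ _ => sigma_comm n (by omega)

/-- A generator under the arc from `i` to `j` commutes with `a_{ji}`. -/
theorem sigma_commute_band {n m i j : ℕ} (hi : 1 ≤ i) (him : i < m) (hmj : m + 1 < j)
    (hj : j ≤ n) : Commute (sigma n m) (band n j i) := by
  induction j, hmj using Nat.le_induction with
  | base =>
    rw [band_succ (by omega), band_succ him]
    have hc : Commute (sigma n (m + 1)) (band n m i) := sigma_commute_band_of_lt him (by omega)
    have hb := sigma_braid (n := n) (i := m) (by omega) (by omega)
    generalize sigma n (m + 1) = y at *
    generalize sigma n m = x at *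
    generalize band n m i = z at *
    have : (y * x)⁻¹ * x * (y * x) = y := by
      rw [mul_assoc, inv_mul_eq_iff_eq_mul, ← mul_assoc, hb]
    have h1 : x * (y * x) = (y * x) * y := by
      rw [← mul_assoc, hb]
    have h2 : Commute x ((y * x) * z * (y * x)⁻¹) := by
      have : x = (y * x) * y * (y * x)⁻¹ := by rw [← h1]; group
      nth_rewrite 1 [this]
      change _ * _ = _ * _
      calc (y * x) * y * (y * x)⁻¹ * ((y * x) * z * (y * x)⁻¹)
          = (y * x) * (y * z) * (y * x)⁻¹ := by group
        _ = (y * x) * (z * y) * (y * x)⁻¹ := by rw [hc.eq]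
        _ = _ := by group
    simpa [mul_assoc] using h2
  | succ j hj' ih =>
    rw [band_succ (by omega)]
    have hc : Commute (sigma n m) (sigma n j) := sigma_comm n (by omega)
    exact (hc.mul_right (ih (by omega))).mul_right hc.inv_right

theorem band_commute_of_lt {n i j k l : ℕ} (hij : i < j) (hkl : k < l) (hjk : j < k) :
    Commute (band n j i) (band n l k) :=
  commute_band hkl fun _ _ _ => (sigma_commute_band_of_lt hij (by omega)).symm

theorem band_commute_of_nested {n i j k l : ℕ} (hi : 1 ≤ i) (hik : i < k) (hkl : k < l)
    (hlj : l < j) (hj : j ≤ n) : Commute (band n j i) (band n l k) :=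
  commute_band hkl fun _ _ _ => (sigma_commute_band hi (by omega) (by omega) hj).symm

/-- First of the two relations `a_{ts} a_{sr} = a_{tr} a_{ts} = a_{sr} a_{tr}` of the dual
presentation. -/
theorem band_mul_band {n r s t : ℕ} (hrs : r < s) (hst : s < t) :
    band n t s * band n s r = band n t r * band n t s := by
  induction t, hst using Nat.le_induction with
  | base => rw [band_succ_self, band_succ hrs]; group
  | succ t hst ih =>
    rw [band_succ (show s < t from hst), band_succ (show r < t by omega)]
    have hc : Commute (sigma n t) (band n s r) := sigma_commute_band_of_lt hrs (by omega)
    generalize sigma n t = x at *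
    calc x * band n t s * x⁻¹ * band n s r = x * band n t s * (x⁻¹ * band n s r) := by group
      _ = x * (band n t s * band n s r) * x⁻¹ := by rw [hc.inv_left.eq]; group
      _ = _ := by rw [ih]; group

/-- The braid relation between `σₛ` and `a_{sr}`. -/
theorem sigma_mul_band_mul_sigma {n r s : ℕ} (hr : 1 ≤ r) (hrs : r < s) (hs : s < n) :
    sigma n s * band n s r * sigma n s = band n s r * sigma n s * band n s r := by
  induction s, hrs using Nat.le_induction with
  | base => rw [band_succ_self]; exact (sigma_braid hr hs).symm
  | succ s hrs ih =>
    have ih := ih (by omega)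
    have hc : Commute (sigma n (s + 1)) (band n s r) := sigma_commute_band_of_lt hrs (by omega)
    have hb := sigma_braid (n := n) (i := s) (by omega) (by omega)
    have he : band n (s + 1) r = (band n s r)⁻¹ * sigma n s * band n s r := by
      rw [band_succ hrs, mul_inv_eq_iff_eq_mul, mul_assoc, mul_assoc, ← inv_mul_eq_iff_eq_mul,
        inv_inv, ← mul_assoc, ← mul_assoc, ih]
    rw [he]
    generalize sigma n (s + 1) = y at *
    generalize sigma n s = x at *
    generalize band n s r = z at *
    calc y * (z⁻¹ * x * z) * y = (y * z⁻¹) * x * (z * y) := by group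
      _ = z⁻¹ * (y * x * y) * z := by rw [← hc.eq, hc.inv_right.eq]; group
      _ = z⁻¹ * x * (y * z) * z⁻¹ * x * z := by rw [← hb]; group
      _ = _ := by rw [hc.eq]; group

/-- Second of the two relations `a_{ts} a_{sr} = a_{tr} a_{ts} = a_{sr} a_{tr}` of the dual
presentation. -/
theorem band_mul_band' {n r s t : ℕ} (hr : 1 ≤ r) (hrs : r < s) (hst : s < t) (ht : t ≤ n) :
    band n t s * band n s r = band n s r * band n t r := by
  induction t, hst using Nat.le_induction with
  | base =>
    rw [band_succ_self, band_succ hrs, ← mul_assoc, ← mul_assoc,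
      ← sigma_mul_band_mul_sigma hr hrs ht]
    group
  | succ t hst ih =>
    rw [band_succ (show s < t from hst), band_succ (show r < t by omega)]
    have hc : Commute (sigma n t) (band n s r) := sigma_commute_band_of_lt hrs (by omega)
    have ih := ih (by omega)
    generalize sigma n t = x at *
    calc x * band n t s * x⁻¹ * band n s r = x * band n t s * (x⁻¹ * band n s r) := by group
      _ = x * (band n t s * band n s r) * x⁻¹ := by rw [hc.inv_left.eq]; group
      _ = (x * band n s r) * band n t r * x⁻¹ := by rw [ih]; group
      _ = _ := by rw [hc.eq]; group

/-- An element that commutes with all the `a_{ji}` for `i`, `j` in a decreasing list commutes with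
the cycle on this list. -/
theorem commute_cycleProd {n : ℕ} {g : BraidGroup n} {l : List ℕ} (hl : l.Pairwise (· > ·))
    (hg : ∀ i ∈ l, ∀ j ∈ l, i < j → Commute g (band n j i)) : Commute g (cycleProd n l) := by
  induction l with
  | nil => exact Commute.one_right g
  | cons i l ih =>
    cases l with
    | nil => exact Commute.one_right g
    | cons j l =>
      rw [cycleProd]
      refine (hg j (by simp) i (by simp) ?_).mul_right (ih hl.of_cons fun a ha b hb =>
        hg a (List.mem_cons_of_mem _ ha) b (List.mem_cons_of_mem _ hb))
      exact List.rel_of_pairwise_cons hl (by simp)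

theorem pairwise_sort (s : Finset ℕ) : (s.sort (· ≥ ·)).Pairwise (· > ·) := s.sortedGT_sort.pairwise

theorem commute_descCycle {n : ℕ} {g : BraidGroup n} {s : Finset ℕ}
    (hg : ∀ i ∈ s, ∀ j ∈ s, i < j → Commute g (band n j i)) : Commute g (descCycle n s) :=
  commute_cycleProd (pairwise_sort s) (by simpa using hg)

/-- The descending cycles of non-crossing sets commute. -/
theorem NonCross.commute {n : ℕ} {s u : Finset ℕ} (hsu : NonCross s u) (hsn : s ⊆ Finset.Icc 1 n)
    (hun : u ⊆ Finset.Icc 1 n) : Commute (descCycle n s) (descCycle n u) := by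
  refine commute_descCycle fun k hk l hl hkl => (commute_descCycle fun i hi j hj hij => ?_).symm
  have hne : ∀ x ∈ s, ∀ y ∈ u, x ≠ y := fun x hx y hy hxy =>
    Finset.disjoint_left.1 hsu.1 hx (hxy ▸ hy)
  have h1 := hne i hi k hk
  have h2 := hne i hi l hl
  have h3 := hne j hj k hk
  have h4 := hne j hj l hl
  have h5 := hsu.2.1 i hi k hk j hj l hl
  have h6 := hsu.2.2 k hk i hi l hl j hj
  have hi' := Finset.mem_Icc.1 (hsn hi)
  have hj' := Finset.mem_Icc.1 (hsn hj)
  have hk' := Finset.mem_Icc.1 (hun hk)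
  have hl' := Finset.mem_Icc.1 (hun hl)
  by_cases c1 : j < k
  · exact (band_commute_of_lt hij hkl c1).symm
  by_cases c2 : l < i
  · exact band_commute_of_lt hkl hij c2
  by_cases c3 : i < k
  · exact (band_commute_of_nested hi'.1 c3 hkl (by omega) hj'.2).symm
  · exact band_commute_of_nested hk'.1 (by omega) hij (by omega) hl'.2

/-! ### The Temperley-Lieb relation between dual generators -/

section TemperleyLiebRepresentation

variable {n : ℕ} {A : Type*} [Ring A] [Algebra ℂ A]

/-- The linear relation between the images under `π` of `1`, `u`, `v`, `uvu⁻¹`, `uv` and `vu` that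
characterises the Temperley-Lieb quotient of the Hecke algebra when `u = σᵢ₊₁` and `v = σᵢ`. It
rewrites the product `vu` in terms of the product `uv` and single factors. -/
def FlipRel (t : ℂ) (π : BraidGroup n →* A) (u v : BraidGroup n) : Prop :=
  π v * π u + t • (π u * π v) + t • π (u * v * u⁻¹) + π u + π v + 1 = 0

/-- A homomorphism from the braid group to an algebra that factors through the Temperley-Lieb
algebra, expressed by relations between the images of the Artin generators. -/
structure IsTLHom (t : ℂ) (π : BraidGroup n →* A) : Prop where
  ne_zero : t ≠ 0
  quad : ∀ m, 1 ≤ m → m < n →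
    π (sigma n m) * π (sigma n m) = (t - 1) • π (sigma n m) + t • (1 : A)
  flip : ∀ m, 1 ≤ m → m + 1 < n → FlipRel t π (sigma n (m + 1)) (sigma n m)

/-- The relation only depends on the pair `(u, v)` up to simultaneous conjugation. -/
theorem FlipRel.conj {t : ℂ} {π : BraidGroup n →* A} {u v : BraidGroup n} (huv : FlipRel t π u v)
    (g : BraidGroup n) : FlipRel t π (g * u * g⁻¹) (g * v * g⁻¹) := by
  unfold FlipRel at *
  have h1 : π g * π g⁻¹ = 1 := by rw [← map_mul, mul_inv_cancel, map_one]
  have key : π g * (π v * π u + t • (π u * π v) + t • π (u * v * u⁻¹) + π u + π v + 1) * π g⁻¹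
      = 0 := by rw [huv, mul_zero, zero_mul]
  simp only [mul_add, add_mul, mul_smul_comm, smul_mul_assoc, mul_one, h1] at key
  rw [← key]
  simp only [← map_mul]
  congr 6 <;> group

/-- The pair `(σₛ, a_{sr})` is conjugate to the pair `(σₛ, σₛ₋₁)`: conjugate by `a_{s-1,r}`. -/
theorem IsTLHom.flip_sigma_band {t : ℂ} {π : BraidGroup n →* A} (hπ : IsTLHom t π) {r s : ℕ}
    (hr : 1 ≤ r) (hrs : r < s) (hs : s < n) : FlipRel t π (sigma n s) (band n s r) := by
  obtain rfl | hrs' := Nat.eq_or_lt_of_le (Nat.succ_le_of_lt hrs)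
  · rw [band_succ_self]; exact hπ.flip r hr hs
  · obtain ⟨s, rfl⟩ : ∃ s', s = s' + 1 := ⟨s - 1, by omega⟩
    have hrs : r < s := by omega
    have hc : Commute (sigma n (s + 1)) (band n s r) := sigma_commute_band_of_lt hrs (by omega)
    have := (hπ.flip s (by omega) hs).conj (band n s r)⁻¹
    rw [inv_inv] at this
    convert this using 1
    · rw [mul_assoc, hc.eq]; group
    · rw [band_succ hrs, mul_inv_eq_iff_eq_mul, mul_assoc, mul_assoc, ← inv_mul_eq_iff_eq_mul,
        inv_inv, ← mul_assoc, ← mul_assoc, sigma_mul_band_mul_sigma hr hrs (by omega)]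

theorem IsTLHom.flip_band {t : ℂ} {π : BraidGroup n →* A} (hπ : IsTLHom t π) {r s u : ℕ}
    (hr : 1 ≤ r) (hrs : r < s) (hsu : s < u) (hu : u ≤ n) :
    FlipRel t π (band n u s) (band n s r) := by
  induction u, hsu using Nat.le_induction with
  | base => rw [band_succ_self]; exact hπ.flip_sigma_band hr hrs hu
  | succ u hsu ih =>
    have hc : Commute (sigma n u) (band n s r) := sigma_commute_band_of_lt hrs (by omega)
    have := (ih (by omega)).conj (sigma n u)
    rwa [← band_succ hsu, hc.eq, mul_inv_cancel_right] at this

/-- Conjugation by `a_{ts} a_{sr}` permutes `a_{ts}`, `a_{sr}`, `a_{tr}` cyclically. -/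
theorem IsTLHom.flip_band' {t : ℂ} {π : BraidGroup n →* A} (hπ : IsTLHom t π) {r s u : ℕ}
    (hr : 1 ≤ r) (hrs : r < s) (hsu : s < u) (hu : u ≤ n) :
    FlipRel t π (band n s r) (band n u r) := by
  have h1 := band_mul_band (n := n) hrs hsu
  have h2 := band_mul_band' (n := n) hr hrs hsu hu
  have := (hπ.flip_band hr hrs hsu hu).conj (band n u s * band n s r)
  generalize band n u s = x at *
  generalize band n s r = y at *
  generalize band n u r = z at *
  have e1 : x * y * x * (x * y)⁻¹ = y := by
    rw [mul_inv_eq_iff_eq_mul, h1, ← mul_assoc, ← h2, h1]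
  have e2 : x * y * y * (x * y)⁻¹ = z := by
    rw [mul_inv_eq_iff_eq_mul, ← mul_assoc, ← h1]
  rwa [e1, e2] at this

/-- To show that `L (vu) R` lies in a subspace, it suffices to show this for the five products into
which the relation rewrites it. The element `uvu⁻¹` is called `w`. -/
theorem FlipRel.mem {t : ℂ} {π : BraidGroup n →* A} {u v w : BraidGroup n} (huv : FlipRel t π u v)
    (hw : u * v = w * u) (S : Submodule ℂ A) (L R : A) (h1 : L * R ∈ S) (hu : L * π u * R ∈ S)
    (hv : L * π v * R ∈ S) (hw' : L * π w * R ∈ S) (huv' : L * (π u * π v) * R ∈ S) :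
    L * (π v * π u) * R ∈ S := by
  unfold FlipRel at huv
  rw [hw, mul_inv_cancel_right] at huv
  have : π v * π u = -(t • (π u * π v) + t • π w + π u + π v + 1) := by
    rw [← sub_eq_zero, sub_neg_eq_add, ← huv]; abel
  rw [this]
  have e : L * -(t • (π u * π v) + t • π w + π u + π v + 1) * R = -(t • (L * (π u * π v) * R)
      + t • (L * π w * R) + L * π u * R + L * π v * R + L * R) := by
    simp only [mul_add, add_mul, mul_neg, neg_mul, mul_smul_comm, smul_mul_assoc, mul_one]
  rw [e]
  exact S.neg_mem (S.add_mem (S.add_mem (S.add_mem (S.add_mem (S.smul_mem _ huv')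
    (S.smul_mem _ hw')) hu) hv) h1)

/-! ### Spanning by products that start with an arc -/

/-- The subalgebra generated by the images of `σₐ, …, σ_{b-1}`. -/
def stdAlg (π : BraidGroup n →* A) (a b : ℕ) : Subalgebra ℂ A :=
  Algebra.adjoin ℂ ((fun m => π (sigma n m)) '' Set.Ico a b)

theorem stdAlg_mono {π : BraidGroup n →* A} {a b c d : ℕ}
    (hab : ∀ m, a ≤ m → m < b → c ≤ m ∧ m < d) : stdAlg π a b ≤ stdAlg π c d := by
  refine Algebra.adjoin_mono ?_
  rintro _ ⟨m, hm, rfl⟩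
  exact ⟨m, hab m hm.1 hm.2, rfl⟩

theorem sigma_mem_stdAlg (π : BraidGroup n →* A) {a b m : ℕ} (ha : a ≤ m) (hb : m < b) :
    π (sigma n m) ∈ stdAlg π a b :=
  Algebra.subset_adjoin ⟨m, ⟨ha, hb⟩, rfl⟩

/-- The inverse of the image of a generator is a linear combination of this image and `1`, so it
lies in the subalgebra as well. -/
theorem IsTLHom.band_mem_stdAlg {t : ℂ} {π : BraidGroup n →* A} (hπ : IsTLHom t π) {a b i j : ℕ}
    (ha : 1 ≤ a) (hai : a ≤ i) (hij : i < j) (hjb : j ≤ b) (hb : b ≤ n) :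
    π (band n j i) ∈ stdAlg π a b := by
  induction j, hij using Nat.le_induction with
  | base => rw [band_succ_self]; exact sigma_mem_stdAlg π hai (by omega)
  | succ j hij ih =>
    have hj : π (sigma n j) ∈ stdAlg π a b := sigma_mem_stdAlg π (by omega) (by omega)
    rw [band_succ hij, map_mul, map_mul]
    refine mul_mem (mul_mem hj (ih (by omega))) ?_
    have hq := hπ.quad j (by omega) (by omega)
    have h1 : π (sigma n j)⁻¹ * π (sigma n j) = 1 := by rw [← map_mul, inv_mul_cancel, map_one]
    have : π (sigma n j)⁻¹ = t⁻¹ • (π (sigma n j) - (t - 1) • (1 : A)) := by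
      have h2 := congrArg (fun z => t⁻¹ • (π (sigma n j)⁻¹ * z)) hq
      simp only [← mul_assoc, h1, one_mul, mul_add, mul_smul_comm, mul_one, smul_add, smul_smul,
        inv_mul_cancel₀ hπ.ne_zero, one_smul] at h2
      rw [smul_sub, smul_smul, h2]; abel
    rw [this]
    exact Subalgebra.smul_mem _ (sub_mem hj (Subalgebra.smul_mem _ (one_mem _) _)) _

theorem commute_of_mem_stdAlg {π : BraidGroup n →* A} {a b : ℕ} {x z : A} (hx : x ∈ stdAlg π a b)
    (hz : ∀ m, a ≤ m → m < b → Commute z (π (sigma n m))) : Commute x z := by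
  induction hx using Algebra.adjoin_induction with
  | mem x hx => obtain ⟨m, hm, rfl⟩ := hx; exact (hz m hm.1 hm.2).symm
  | algebraMap r => exact Algebra.commutes r z
  | add x y _ _ hx hy => exact hx.add_left hy
  | mul x y _ _ hx hy => exact hx.mul_left hy

theorem commute_stdAlg_sigma {π : BraidGroup n →* A} {a b m : ℕ} {x : A} (hx : x ∈ stdAlg π a b)
    (hm : b < m) : Commute x (π (sigma n m)) :=
  commute_of_mem_stdAlg hx fun i _ hi => (sigma_comm n (by omega)).map π

theorem commute_stdAlg_stdAlg {π : BraidGroup n →* A} {a b c d : ℕ} {x y : A}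
    (hx : x ∈ stdAlg π a b) (hy : y ∈ stdAlg π c d) (hbc : b < c) : Commute x y :=
  (commute_of_mem_stdAlg hy fun _ hm _ => commute_stdAlg_sigma hx (by omega)).symm

/-- The elements under an arc commute with it. -/
theorem commute_stdAlg_band {π : BraidGroup n →* A} {k b : ℕ} {y : A} (hk : 1 ≤ k) (hb : b + 1 ≤ n)
    (hy : y ∈ stdAlg π (k + 1) b) : Commute y (π (band n (b + 1) k)) :=
  commute_of_mem_stdAlg hy fun _ hm hm' =>
    ((sigma_commute_band hk (by omega) (by omega) hb).map π).symm

/-- Spanning set of the algebra of the strands `a, …, b`, sorted by the neighbour `k` of `b` in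
its block of a non-crossing partition: below the arc from `k` to `b` lives the algebra of the
strands `k + 1, …, b - 1`, outside of it the algebra of the strands `a, …, k`. -/
def arcSet (π : BraidGroup n →* A) (a b : ℕ) : Set A :=
  {z | z ∈ stdAlg π a (b - 1) ∨ ∃ k x y, a ≤ k ∧ k < b ∧ x ∈ stdAlg π a k ∧
    y ∈ stdAlg π (k + 1) (b - 1) ∧ z = π (band n b k) * x * y}

theorem mul_mul_mem_of_mem_span {G : Set A} {S : Submodule ℂ A} {x : A} (L R : A)
    (hx : x ∈ Submodule.span ℂ G) (hG : ∀ g ∈ G, L * g * R ∈ S) : L * x * R ∈ S := by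
  induction hx using Submodule.span_induction with
  | mem x hx => exact hG x hx
  | zero => simp
  | add x y _ _ hx hy => rw [mul_add, add_mul]; exact S.add_mem hx hy
  | smul c x _ hx => rw [mul_smul_comm, smul_mul_assoc]; exact S.smul_mem c hx

/-- A subspace that contains `1` and is closed under right multiplication by the generators of a
subalgebra contains this subalgebra. -/
theorem adjoin_le_of_mul_mem {G : Set A} {S : Submodule ℂ A} (h1 : 1 ∈ S)
    (hG : ∀ z ∈ S, ∀ g ∈ G, z * g ∈ S) {x : A} (hx : x ∈ Algebra.adjoin ℂ G) : x ∈ S := by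
  suffices h : ∀ z ∈ S, z * x ∈ S by simpa using h 1 h1
  induction hx using Algebra.adjoin_induction with
  | mem x hx => exact fun z hz => hG z hz x hx
  | algebraMap r =>
    intro z hz
    rw [← Algebra.commutes, ← Algebra.smul_def]
    exact S.smul_mem r hz
  | add x y _ _ hx hy => intro z hz; rw [mul_add]; exact S.add_mem (hx z hz) (hy z hz)
  | mul x y _ _ hx hy => intro z hz; rw [← mul_assoc]; exact hy _ (hx z hz)

section Closure

variable {t : ℂ} {π : BraidGroup n →* A} {a b : ℕ}

theorem mem_span_arcSet_of_mem {x : A} (hx : x ∈ stdAlg π a b) :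
    x ∈ Submodule.span ℂ (arcSet π a (b + 1)) :=
  Submodule.subset_span (Or.inl (by simpa using hx))

theorem arc_mul_mem_span {k : ℕ} {x y : A} (hak : a ≤ k) (hkb : k ≤ b) (hx : x ∈ stdAlg π a k)
    (hy : y ∈ stdAlg π (k + 1) b) :
    π (band n (b + 1) k) * x * y ∈ Submodule.span ℂ (arcSet π a (b + 1)) :=
  Submodule.subset_span (Or.inr ⟨k, x, y, hak, by omega, hx, by simpa using hy, rfl⟩)

theorem sigma_mul_mem_span {x : A} (hab : a ≤ b) (hx : x ∈ stdAlg π a b) :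
    π (sigma n b) * x ∈ Submodule.span ℂ (arcSet π a (b + 1)) := by
  have := arc_mul_mem_span (π := π) hab le_rfl hx (one_mem (stdAlg π (b + 1) b))
  rwa [band_succ_self, mul_one] at this

/-- The inductive hypothesis of the spanning argument: the algebra of fewer strands than
`a, …, b + 1` is spanned by the products that start with an arc. -/
def ArcSpans (π : BraidGroup n →* A) (a b : ℕ) : Prop :=
  ∀ c d, 1 ≤ c → c ≤ d → d ≤ n → d + a < b + 1 + c → ∀ x ∈ stdAlg π c d,
    x ∈ Submodule.span ℂ (arcSet π c d)

/-- Multiplication by the last generator `σ_b` of the elements that do not involve it: after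
decomposing these, `a_{bl} σ_b` is rewritten by the flip relation. -/
theorem mul_sigma_top_mem_of_stdAlg (hπ : IsTLHom t π) (ha : 1 ≤ a) (hab : a ≤ b) (hb : b + 1 ≤ n)
    (ih : ArcSpans π a b) {x : A} (hx : x ∈ stdAlg π a b) :
    x * π (sigma n b) ∈ Submodule.span ℂ (arcSet π a (b + 1)) := by
  have hx' := ih a b ha hab (by omega) (by omega) x hx
  rw [← one_mul x]
  refine mul_mul_mem_of_mem_span 1 _ hx' ?_
  rintro _ (hg | ⟨l, y, z, hal, hlb, hy, hz, rfl⟩)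
  · rw [one_mul, (commute_stdAlg_sigma hg (by omega)).eq]
    exact sigma_mul_mem_span hab (stdAlg_mono (by omega) hg)
  · have hy' : y ∈ stdAlg π a b := stdAlg_mono (by omega) hy
    have hz' : z ∈ stdAlg π a b := stdAlg_mono (by omega) hz
    have hB := hπ.band_mem_stdAlg ha hal hlb le_rfl (by omega)
    have hc1 : Commute y (π (sigma n b)) := commute_stdAlg_sigma hy hlb
    have hc2 : Commute z (π (sigma n b)) := commute_stdAlg_sigma hz (by omega)
    have e : 1 * (π (band n b l) * y * z) * π (sigma n b)
        = 1 * (π (band n b l) * π (band n (b + 1) b)) * (y * z) := by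
      rw [band_succ_self, one_mul, one_mul, mul_assoc, hc2.eq, mul_assoc, ← mul_assoc y, hc1.eq]
      simp only [mul_assoc]
    rw [e]
    refine FlipRel.mem (hπ.flip_band (by omega) hlb (by omega) hb)
      (band_mul_band hlb (by omega)) _ _ _ ?_ ?_ ?_ ?_ ?_ <;> rw [one_mul]
    · exact mem_span_arcSet_of_mem (mul_mem hy' hz')
    · rw [band_succ_self]; exact sigma_mul_mem_span hab (mul_mem hy' hz')
    · exact mem_span_arcSet_of_mem (mul_mem hB (mul_mem hy' hz'))
    · rw [← mul_assoc]
      exact arc_mul_mem_span hal hlb.le hy (stdAlg_mono (by omega) hz)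
    · rw [band_succ_self, mul_assoc]
      exact sigma_mul_mem_span hab (mul_mem hB (mul_mem hy' hz'))

/-- Multiplication by the last generator `σ_b` of a product that starts with the arc from `k < b` to
`b + 1`. The part `y` below the arc is decomposed, which leads to the products
`a_{b+1,k} a_{bl} σ_b`. -/
theorem arc_mul_sigma_top_mem (hπ : IsTLHom t π) (ha : 1 ≤ a) (hb : b + 1 ≤ n)
    (ih : ArcSpans π a b) {k : ℕ} (hak : a ≤ k) (hkb : k < b) {x y : A} (hx : x ∈ stdAlg π a k)
    (hy : y ∈ stdAlg π (k + 1) b) :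
    π (band n (b + 1) k) * x * y * π (sigma n b) ∈ Submodule.span ℂ (arcSet π a (b + 1)) := by
  have hab : a ≤ b := by omega
  have hxb : x ∈ stdAlg π a b := stdAlg_mono (by omega) hx
  have hcx : Commute x (π (sigma n b)) := commute_stdAlg_sigma hx hkb
  have hB := hπ.band_mem_stdAlg ha hak hkb le_rfl (by omega)
  have hN : π (band n (b + 1) k) * π (sigma n b) = π (sigma n b) * π (band n b k) := by
    rw [← map_mul, ← map_mul, ← band_succ_self, band_mul_band hkb (by omega)]
  have hy' := ih (k + 1) b (by omega) (by omega) (by omega) (by omega) y hy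
  refine mul_mul_mem_of_mem_span _ _ hy' ?_
  rintro _ (hg | ⟨l, y, z, hkl, hlb, hy, hz, rfl⟩)
  · rename_i g
    have hg' : g ∈ stdAlg π a b := stdAlg_mono (by omega) hg
    rw [mul_assoc, (commute_stdAlg_sigma hg (by omega)).eq, mul_assoc, ← mul_assoc x, hcx.eq,
      mul_assoc, ← mul_assoc, hN, mul_assoc]
    exact sigma_mul_mem_span hab (mul_mem hB (mul_mem hxb hg'))
  · have hyb : y ∈ stdAlg π (k + 1) b := stdAlg_mono (by omega) hy
    have hzb : z ∈ stdAlg π (k + 1) b := stdAlg_mono (by omega) hz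
    have hya : y ∈ stdAlg π a b := stdAlg_mono (by omega) hy
    have hza : z ∈ stdAlg π a b := stdAlg_mono (by omega) hz
    have hBl := hπ.band_mem_stdAlg ha (by omega) hlb le_rfl (b := b) (by omega)
    have hBl' := hπ.band_mem_stdAlg (by omega) hkl hlb le_rfl (b := b) (by omega)
    have hc1 : Commute y (π (sigma n b)) := commute_stdAlg_sigma hy hlb
    have hc2 : Commute z (π (sigma n b)) := commute_stdAlg_sigma hz (by omega)
    have hcB : Commute x (π (band n b l)) := commute_stdAlg_stdAlg hx hBl' (by omega)
    have e : π (band n (b + 1) k) * x * (π (band n b l) * y * z) * π (sigma n b)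
        = π (band n (b + 1) k) * (π (band n b l) * π (band n (b + 1) b)) * (x * y * z) := by
      rw [band_succ_self]
      calc _ = π (band n (b + 1) k) * (x * π (band n b l)) * y * (z * π (sigma n b)) := by
            simp only [mul_assoc]
        _ = π (band n (b + 1) k) * π (band n b l) * x * (y * π (sigma n b)) * z := by
            rw [hc2.eq, hcB.eq]; simp only [mul_assoc]
        _ = π (band n (b + 1) k) * π (band n b l) * (x * π (sigma n b)) * y * z := by
            rw [hc1.eq]; simp only [mul_assoc]
        _ = _ := by rw [hcx.eq]; simp only [mul_assoc]
    rw [e]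
    have hxyz : x * y * z ∈ stdAlg π a b := mul_mem (mul_mem hxb hya) hza
    refine FlipRel.mem (hπ.flip_band (by omega) hlb (by omega) hb)
      (band_mul_band hlb (by omega)) _ _ _ ?_ ?_ ?_ ?_ ?_
    · rw [← mul_assoc, ← mul_assoc, mul_assoc _ y]
      exact arc_mul_mem_span hak hkb.le hx (mul_mem hyb hzb)
    · rw [band_succ_self, hN, mul_assoc]
      exact sigma_mul_mem_span hab (mul_mem hB hxyz)
    · have : π (band n (b + 1) k) * π (band n b l) * (x * y * z) =
          π (band n (b + 1) k) * x * (π (band n b l) * y * z) := by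
        rw [mul_assoc x, ← mul_assoc _ x, mul_assoc _ _ x, ← hcB.eq]; simp only [mul_assoc]
      rw [this]
      exact arc_mul_mem_span hak hkb.le hx (mul_mem (mul_mem hBl' hyb) hzb)
    · rw [← map_mul, ← band_mul_band (show k < l by omega) (by omega), map_mul, mul_assoc,
        mul_assoc x, ← mul_assoc x, ← mul_assoc (π (band n l k)), ← mul_assoc]
      refine arc_mul_mem_span (by omega) hlb.le (mul_mem (hπ.band_mem_stdAlg ha hak hkl le_rfl
        (by omega)) (mul_mem (stdAlg_mono (by omega) hx) (stdAlg_mono (by omega) hy)))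
        (stdAlg_mono (by omega) hz)
    · rw [band_succ_self, ← mul_assoc _ (π (sigma n b)), hN, mul_assoc, mul_assoc]
      exact sigma_mul_mem_span hab (mul_mem hB (mul_mem hBl hxyz))

/-- Multiplication by the last generator `σ_b` of a product that starts with it; here
`σ_b a_{bl} σ_b = a_{b+1,l} σ_b²`. -/
theorem sigma_mul_sigma_top_mem (hπ : IsTLHom t π) (ha : 1 ≤ a) (hab : a ≤ b) (hb : b + 1 ≤ n)
    (ih : ArcSpans π a b) {x : A} (hx : x ∈ stdAlg π a b) :
    π (sigma n b) * x * π (sigma n b) ∈ Submodule.span ℂ (arcSet π a (b + 1)) := by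
  have hq := hπ.quad b (by omega) (by omega)
  have hx' := ih a b ha hab (by omega) (by omega) x hx
  refine mul_mul_mem_of_mem_span _ _ hx' ?_
  rintro _ (hg | ⟨l, y, z, hal, hlb, hy, hz, rfl⟩)
  · rename_i g
    have hg' : g ∈ stdAlg π a b := stdAlg_mono (by omega) hg
    rw [mul_assoc, (commute_stdAlg_sigma hg (by omega)).eq, ← mul_assoc, hq, add_mul,
      smul_mul_assoc, smul_mul_assoc, one_mul]
    exact Submodule.add_mem _ (Submodule.smul_mem _ _ (sigma_mul_mem_span hab hg'))
      (Submodule.smul_mem _ _ (mem_span_arcSet_of_mem hg'))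
  · have hy' : y ∈ stdAlg π a b := stdAlg_mono (by omega) hy
    have hz' : z ∈ stdAlg π a b := stdAlg_mono (by omega) hz
    have hB := hπ.band_mem_stdAlg ha hal hlb le_rfl (by omega)
    have hc1 : Commute y (π (sigma n b)) := commute_stdAlg_sigma hy hlb
    have hc2 : Commute z (π (sigma n b)) := commute_stdAlg_sigma hz (by omega)
    have hN : π (band n (b + 1) l) * π (sigma n b) = π (sigma n b) * π (band n b l) := by
      rw [← map_mul, ← map_mul, ← band_succ_self, band_mul_band hlb (by omega)]
    have e : π (sigma n b) * (π (band n b l) * y * z) * π (sigma n b)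
        = (t - 1) • (π (sigma n b) * (π (band n b l) * (y * z))) +
          t • (π (band n (b + 1) l) * y * z) := by
      calc _ = π (sigma n b) * π (band n b l) * y * (z * π (sigma n b)) := by
            simp only [mul_assoc]
        _ = π (sigma n b) * π (band n b l) * (y * π (sigma n b)) * z := by
            rw [hc2.eq]; simp only [mul_assoc]
        _ = π (band n (b + 1) l) * (π (sigma n b) * π (sigma n b)) * (y * z) := by
            rw [hc1.eq, ← hN]; simp only [mul_assoc]
        _ = _ := by
            rw [hq, mul_add, add_mul, mul_smul_comm, smul_mul_assoc, mul_smul_comm,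
              smul_mul_assoc, mul_one, hN]
            simp only [mul_assoc]
    rw [e]
    exact Submodule.add_mem _ (Submodule.smul_mem _ _ (sigma_mul_mem_span hab
        (mul_mem hB (mul_mem hy' hz'))))
      (Submodule.smul_mem _ _ (arc_mul_mem_span hal hlb.le hy (stdAlg_mono (by omega) hz)))

/-- The factor below the arc does not commute with the arc from `k + 1`, but both lie in the
algebra of the strands `k + 1, …, b + 1`, to which the inductive hypothesis applies. -/
theorem stdAlg_mul_arc_mem (hπ : IsTLHom t π) (hb : b + 1 ≤ n) (ih : ArcSpans π a b) {k : ℕ}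
    (hak : a ≤ k) (hkb : k < b) {x y : A} (hx : x ∈ stdAlg π a (k + 1))
    (hy : y ∈ stdAlg π (k + 1) b) :
    y * π (band n (b + 1) (k + 1)) * x ∈ Submodule.span ℂ (arcSet π a (b + 1)) := by
  have hyN : y * π (band n (b + 1) (k + 1)) ∈ stdAlg π (k + 1) (b + 1) :=
    mul_mem (stdAlg_mono (by omega) hy)
      (hπ.band_mem_stdAlg (by omega) le_rfl (by omega) le_rfl hb)
  have := ih (k + 1) (b + 1) (by omega) (by omega) hb (by omega) _ hyN
  rw [← one_mul (y * _)]
  refine mul_mul_mem_of_mem_span 1 x this ?_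
  rintro _ (hg | ⟨m, x₁, x₂, hm, hmb, hx₁, hx₂, rfl⟩)
  · rw [one_mul]
    exact mem_span_arcSet_of_mem (mul_mem (stdAlg_mono (by omega) hg) (stdAlg_mono (by omega) hx))
  · have hc : Commute x x₂ := commute_stdAlg_stdAlg hx hx₂ (by omega)
    rw [one_mul, mul_assoc, ← hc.eq, ← mul_assoc, mul_assoc _ x₁]
    exact arc_mul_mem_span (by omega) (by omega) (mul_mem (stdAlg_mono (by omega) hx₁)
      (stdAlg_mono (by omega) hx)) hx₂

/-- Multiplication by the generator `σ_k` of a product that starts with the arc from `k` to `b + 1`: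
the only generator, other than the last one, that respects neither of the two sides of the arc. -/
theorem arc_mul_sigma_foot_mem (hπ : IsTLHom t π) (ha : 1 ≤ a) (hb : b + 1 ≤ n)
    (ih : ArcSpans π a b) {k : ℕ} (hak : a ≤ k) (hkb : k < b) {x y : A} (hx : x ∈ stdAlg π a k)
    (hy : y ∈ stdAlg π (k + 1) b) :
    π (band n (b + 1) k) * x * y * π (sigma n k) ∈ Submodule.span ℂ (arcSet π a (b + 1)) := by
  have hcB {l : ℕ} (hal : a ≤ l) (hlk : l ≤ k) : Commute y (π (band n (b + 1) l)) :=
    commute_stdAlg_band (by omega) hb (stdAlg_mono (by omega) hy)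
  have hya : y ∈ stdAlg π a b := stdAlg_mono (by omega) hy
  have hleft {l : ℕ} (hal : a ≤ l) (hlk : l ≤ k) {u v : A} (hu : u ∈ stdAlg π a l)
      (hv : v ∈ stdAlg π (l + 1) b) :
      y * π (band n (b + 1) l) * (u * v) ∈ Submodule.span ℂ (arcSet π a (b + 1)) := by
    have hc : Commute u y := commute_stdAlg_stdAlg hu hy (by omega)
    rw [(hcB hal hlk).eq, mul_assoc, ← mul_assoc y, ← hc.eq, mul_assoc, ← mul_assoc]
    exact arc_mul_mem_span hal (by omega) hu (mul_mem (stdAlg_mono (by omega) hy) hv)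
  have hcx : Commute x y := commute_stdAlg_stdAlg hx hy (by omega)
  have e : π (band n (b + 1) k) * x * y * π (sigma n k)
      = (y * π (band n (b + 1) k)) * x * π (sigma n k) := by
    rw [mul_assoc _ x, hcx.eq, ← mul_assoc, (hcB hak le_rfl).eq]
  rw [e]
  have hS : π (sigma n k) ∈ stdAlg π a (k + 1) := sigma_mem_stdAlg π hak (by omega)
  -- the flip of `a_{b+1,k} σ_k`, with arbitrary factors on both sides
  have hflip (L R : A) (h1 : L * R ∈ Submodule.span ℂ (arcSet π a (b + 1)))
      (h2 : L * π (sigma n k) * R ∈ Submodule.span ℂ (arcSet π a (b + 1)))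
      (h3 : L * π (band n (b + 1) k) * R ∈ Submodule.span ℂ (arcSet π a (b + 1)))
      (h4 : L * π (band n (b + 1) (k + 1)) * R ∈ Submodule.span ℂ (arcSet π a (b + 1)))
      (h5 : L * π (band n (b + 1) (k + 1)) * π (sigma n k) * R
        ∈ Submodule.span ℂ (arcSet π a (b + 1))) :
      L * (π (band n (b + 1) k) * π (sigma n k)) * R
        ∈ Submodule.span ℂ (arcSet π a (b + 1)) := by
    have hrel := band_mul_band' (n := n) (r := k) (s := k + 1) (t := b + 1) (by omega) (by omega)
      (by omega) hb
    rw [← band_succ_self] at h2 h5 ⊢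
    refine FlipRel.mem (hπ.flip_band' (by omega) (by omega) (by omega) hb) hrel.symm _ _ _ h1 h2
      h3 h4 ?_
    rwa [← map_mul, ← hrel, map_mul, ← mul_assoc]
  have hx' := ih a k ha hak (by omega) (by omega) x hx
  refine mul_mul_mem_of_mem_span _ _ hx' ?_
  rintro _ (hg | ⟨l, x₁, x₂, hal, hlk, hx₁, hx₂, rfl⟩)
  · rename_i g
    have hga : g ∈ stdAlg π a b := stdAlg_mono (by omega) hg
    have hgk : g ∈ stdAlg π a (k + 1) := stdAlg_mono (by omega) hg
    rw [mul_assoc, (commute_stdAlg_sigma hg (by omega)).eq, ← mul_assoc, mul_assoc y]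
    refine hflip y g ?_ ?_ ?_ ?_ ?_
    · exact mem_span_arcSet_of_mem (mul_mem hya hga)
    · exact mem_span_arcSet_of_mem (mul_mem (mul_mem hya (stdAlg_mono (by omega) hS)) hga)
    · rw [← mul_one g]
      exact hleft hak le_rfl (stdAlg_mono (by omega) hg) (one_mem _)
    · exact stdAlg_mul_arc_mem hπ hb ih hak hkb hgk hy
    · rw [mul_assoc _ (π (sigma n k))]
      exact stdAlg_mul_arc_mem hπ hb ih hak hkb (mul_mem hS hgk) hy
  · have hc1 : Commute x₁ (π (sigma n k)) := commute_stdAlg_sigma hx₁ hlk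
    have hc2 : Commute x₂ (π (sigma n k)) := commute_stdAlg_sigma hx₂ (by omega)
    have hN : π (band n (b + 1) k) * π (band n k l)
        = π (band n (b + 1) l) * π (band n (b + 1) k) := by
      rw [← map_mul, ← map_mul, band_mul_band hlk (by omega)]
    have e : y * π (band n (b + 1) k) * (π (band n k l) * x₁ * x₂) * π (sigma n k)
        = y * π (band n (b + 1) l) * (π (band n (b + 1) k) * π (sigma n k)) * (x₁ * x₂) := by
      calc _ = y * (π (band n (b + 1) k) * π (band n k l)) * x₁ * (x₂ * π (sigma n k)) := by
            simp only [mul_assoc]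
        _ = y * (π (band n (b + 1) k) * π (band n k l)) * (x₁ * π (sigma n k)) * x₂ := by
            rw [hc2.eq]; simp only [mul_assoc]
        _ = _ := by rw [hc1.eq, hN]; simp only [mul_assoc]
    rw [e]
    have hSl : π (sigma n k) ∈ stdAlg π (l + 1) b := sigma_mem_stdAlg π (by omega) hkb
    have hx₂b : x₂ ∈ stdAlg π (l + 1) b := stdAlg_mono (by omega) hx₂
    have hxx : x₁ * x₂ ∈ stdAlg π a k :=
      mul_mem (stdAlg_mono (by omega) hx₁) (stdAlg_mono (by omega) hx₂)
    have hN' : π (band n (b + 1) l) * π (band n (b + 1) (k + 1))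
        = π (band n (b + 1) (k + 1)) * π (band n (k + 1) l) := by
      rw [← map_mul, ← map_mul, band_mul_band (show l < k + 1 by omega) (by omega)]
    have hBk : π (band n (k + 1) l) ∈ stdAlg π a (k + 1) :=
      hπ.band_mem_stdAlg ha hal (by omega) le_rfl (by omega)
    have hxx' : x₁ * x₂ ∈ stdAlg π a (k + 1) := stdAlg_mono (by omega) hxx
    refine hflip _ _ ?_ ?_ ?_ ?_ ?_
    · exact hleft hal hlk.le hx₁ hx₂b
    · rw [mul_assoc, ← mul_assoc _ x₁, ← hc1.eq, mul_assoc x₁]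
      exact hleft hal hlk.le hx₁ (mul_mem hSl hx₂b)
    · rw [mul_assoc y, ← hN, ← mul_assoc y, mul_assoc _ (π (band n k l)),
        ← mul_one (π (band n k l) * _)]
      exact hleft hak le_rfl (mul_mem (hπ.band_mem_stdAlg ha hal hlk le_rfl (by omega)) hxx)
        (one_mem _)
    · rw [mul_assoc y, hN', ← mul_assoc y, mul_assoc _ (π (band n (k + 1) l))]
      exact stdAlg_mul_arc_mem hπ hb ih hak hkb (mul_mem hBk hxx') hy
    · rw [mul_assoc y, hN', ← mul_assoc y, mul_assoc _ (π (band n (k + 1) l)),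
        mul_assoc _ _ (x₁ * x₂)]
      exact stdAlg_mul_arc_mem hπ hb ih hak hkb (mul_mem (mul_mem hBk hS) hxx') hy

/-- The span of the products that start with an arc is a right ideal. -/
theorem mul_sigma_mem (hπ : IsTLHom t π) (ha : 1 ≤ a) (hab : a ≤ b) (hb : b + 1 ≤ n)
    (ih : ArcSpans π a b) {m : ℕ} (ham : a ≤ m) (hmb : m ≤ b) {z : A}
    (hz : z ∈ Submodule.span ℂ (arcSet π a (b + 1))) :
    z * π (sigma n m) ∈ Submodule.span ℂ (arcSet π a (b + 1)) := by
  rw [← one_mul z]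
  refine mul_mul_mem_of_mem_span 1 _ hz ?_
  rintro _ (hg | ⟨k, x, y, hak, hkb, hx, hy, rfl⟩) <;> rw [one_mul]
  · rw [Nat.add_sub_cancel] at hg
    rcases hmb.eq_or_lt with rfl | hmb
    · exact mul_sigma_top_mem_of_stdAlg hπ ha hab hb ih hg
    · exact mem_span_arcSet_of_mem (mul_mem hg (sigma_mem_stdAlg π ham hmb))
  · rw [Nat.add_sub_cancel] at hy
    rcases lt_trichotomy m k with hmk | rfl | hmk
    · have hS : π (sigma n m) ∈ stdAlg π a k := sigma_mem_stdAlg π ham hmk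
      have hc : Commute (π (sigma n m)) y := commute_stdAlg_stdAlg hS hy (by omega)
      rw [mul_assoc, ← hc.eq, ← mul_assoc, mul_assoc _ x]
      exact arc_mul_mem_span hak (by omega) (mul_mem hx hS) hy
    · rcases hmb.eq_or_lt with rfl | hmb
      · rw [band_succ_self, mul_assoc (π (sigma n m))]
        exact sigma_mul_sigma_top_mem hπ ha hab hb ih
          (mul_mem hx (stdAlg_mono (by omega) hy))
      · exact arc_mul_sigma_foot_mem hπ ha hb ih ham hmb hx hy
    · rcases hmb.eq_or_lt with rfl | hmb
      · exact arc_mul_sigma_top_mem hπ ha hb ih hak hmk hx hy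
      · rw [mul_assoc]
        exact arc_mul_mem_span hak (by omega) hx (mul_mem hy (sigma_mem_stdAlg π hmk hmb))

end Closure

theorem IsTLHom.mem_span_arcSet {t : ℂ} {π : BraidGroup n →* A} (hπ : IsTLHom t π) {a b : ℕ}
    (ha : 1 ≤ a) (hab : a ≤ b) (hb : b ≤ n) {x : A} (hx : x ∈ stdAlg π a b) :
    x ∈ Submodule.span ℂ (arcSet π a b) := by
  obtain ⟨d, hd⟩ : ∃ d, d = b - a := ⟨_, rfl⟩
  induction d using Nat.strong_induction_on generalizing a b x with
  | _ d ih =>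
    rcases hab.eq_or_lt with rfl | hab
    · exact Submodule.subset_span (Or.inl (stdAlg_mono (by omega) hx))
    · obtain ⟨b, rfl⟩ : ∃ b', b = b' + 1 := ⟨b - 1, by omega⟩
      have hspan : ArcSpans π a b := fun c d' hc hcd hd' hlt y hy =>
        ih (d' - c) (by omega) hc hcd hd' hy rfl
      refine adjoin_le_of_mul_mem (mem_span_arcSet_of_mem (one_mem _)) ?_ hx
      rintro z hz _ ⟨m, hm, rfl⟩
      exact mul_sigma_mem hπ ha (by omega) hb hspan hm.1 (by have := hm.2; omega) hz

end TemperleyLiebRepresentation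

/-! ### Products of non-crossing descending cycles -/

theorem nonCross_of_lt {s u : Finset ℕ} (hsu : ∀ x ∈ s, ∀ y ∈ u, x < y) : NonCross s u := by
  refine ⟨Finset.disjoint_left.2 fun x hx hx' => lt_irrefl x (hsu x hx x hx'), ?_, ?_⟩
  · intro a _ b hb c hc d _ _ hbc _
    exact absurd (hsu c hc b hb) (by omega)
  · intro a ha b hb _ _ _ _ hab _ _
    exact absurd (hsu b hb a ha) (by omega)

theorem nonCross_singleton {k : ℕ} {u : Finset ℕ} (hk : k ∉ u) : NonCross {k} u := by
  refine ⟨Finset.disjoint_singleton_left.2 hk, ?_, ?_⟩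
  · intro a ha b _ c hc d _ _ _ _
    rw [Finset.mem_singleton] at ha hc
    omega
  · intro a _ b hb c _ d hd _ _ _
    rw [Finset.mem_singleton] at hb hd
    omega

/-- Adding to a set an element that is larger than everything and sees the maximum `k` of the set
does not create crossings with sets below `k`. -/
theorem NonCross.insert_of_le {s u : Finset ℕ} {b k : ℕ} (hsu : NonCross s u) (hk : k ∈ s)
    (hkb : k < b) (hu : ∀ x ∈ u, x ≤ k) : NonCross (insert b s) u := by
  have hb : b ∉ u := fun hb => absurd (hu b hb) (by omega)
  have hku : ∀ x ∈ u, x < k := fun x hx => lt_of_le_of_ne (hu x hx) fun h =>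
    Finset.disjoint_left.1 hsu.1 hk (h ▸ hx)
  refine ⟨Finset.disjoint_insert_left.2 ⟨hb, hsu.1⟩, ?_, ?_⟩
  · intro x hx y hy z hz w hw hxy hyz hzw
    have := hku w hw
    rcases Finset.mem_insert.1 hx with rfl | hx
    · omega
    rcases Finset.mem_insert.1 hz with rfl | hz
    · omega
    exact hsu.2.1 x hx y hy z hz w hw hxy hyz hzw
  · intro x hx y hy z hz w hw hxy hyz hzw
    have hzk := hku z hz
    rcases Finset.mem_insert.1 hy with rfl | hy
    · omega
    exact hsu.2.2 x hx y hy z hz k hk hxy hyz hzk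

theorem nonCross_insert_of_between {s u : Finset ℕ} {b k : ℕ} (hs : ∀ x ∈ s, x ≤ k)
    (hu : ∀ x ∈ u, k < x ∧ x < b) : NonCross (insert b s) u := by
  refine ⟨Finset.disjoint_left.2 fun x hx hx' => ?_, ?_, ?_⟩
  · have := hu x hx'
    rcases Finset.mem_insert.1 hx with rfl | hx
    · omega
    · have := hs x hx; omega
  · intro x hx y hy z hz w hw hxy hyz hzw
    have := hu y hy
    have := hu w hw
    rcases Finset.mem_insert.1 hz with rfl | hz
    · omega
    · have := hs z hz; omega
  · intro x hx y hy z hz w hw hxy hyz hzw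
    have := hu x hx
    have := hu z hz
    rcases Finset.mem_insert.1 hy with rfl | hy
    · omega
    · have := hs y hy; omega

theorem descCycle_singleton (n k : ℕ) : descCycle n {k} = 1 := by
  simp [descCycle, cycleProd]

theorem descCycle_insert (n : ℕ) {s : Finset ℕ} {b k : ℕ} (hk : k ∈ s) (hs : ∀ x ∈ s, x ≤ k)
    (hkb : k < b) : descCycle n (insert b s) = band n b k * descCycle n s := by
  have hb : b ∉ s := fun h => absurd (hs b h) (by omega)
  have e : s.sort (· ≥ ·) = k :: (s.erase k).sort (· ≥ ·) := by
    conv_lhs => rw [← Finset.insert_erase hk]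
    exact Finset.sort_insert (r := (· ≥ ·)) (fun x hx => hs x (Finset.mem_of_mem_erase hx))
      (Finset.notMem_erase k s)
  rw [descCycle, descCycle,
    Finset.sort_insert (r := (· ≥ ·)) (fun x hx => (hs x hx).trans hkb.le) hb, e, cycleProd]

/-- The products of pairwise non-crossing descending cycles on the strands `a, …, b`. -/
def simpleSet (n a b : ℕ) : Set (BraidGroup n) :=
  {g | ∃ l : List (Finset ℕ), (∀ s ∈ l, s.Nonempty ∧ s ⊆ Finset.Icc a b) ∧
    l.Pairwise NonCross ∧ g = (l.map (descCycle n)).prod}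

theorem simpleSet_eq_simpleElements (n : ℕ) : simpleSet n 1 n = simpleElements n := by
  ext g
  constructor
  · rintro ⟨l, hl, hp, rfl⟩
    exact ⟨l, hl, hp.imp_of_mem fun hs hu hsu =>
      hsu.parallel (hl _ hs).1 (hl _ hu).1 (hl _ hs).2 (hl _ hu).2, rfl⟩
  · rintro ⟨l, hl, hp, rfl⟩
    exact ⟨l, hl, hp.imp_of_mem fun hs hu hsu => hsu.nonCross (hl _ hs).2 (hl _ hu).2, rfl⟩

theorem one_mem_simpleSet (n a b : ℕ) : 1 ∈ simpleSet n a b := ⟨[], by simp, by simp, by simp⟩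

theorem simpleSet_mono {n a b c : ℕ} (hbc : b ≤ c) : simpleSet n a b ⊆ simpleSet n a c := by
  rintro _ ⟨l, hl, hp, rfl⟩
  exact ⟨l, fun s hs => ⟨(hl s hs).1, (hl s hs).2.trans (Finset.Icc_subset_Icc le_rfl hbc)⟩, hp,
    rfl⟩

theorem pairwise_commute {n : ℕ} {l : List (Finset ℕ)} (hl : ∀ s ∈ l, s ⊆ Finset.Icc 1 n)
    (hp : l.Pairwise NonCross) : (l.map (descCycle n)).Pairwise Commute := by
  rw [List.pairwise_map]
  exact hp.imp_of_mem fun hs hu hsu => hsu.commute (hl _ hs) (hl _ hu)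

/-- Singletons do not matter in a product of descending cycles, so a given index may be assumed to
be covered, and by the first factor. -/
theorem exists_cons_of_mem_simpleSet {n a k : ℕ} {g : BraidGroup n} (ha : 1 ≤ a) (hak : a ≤ k)
    (hk : k ≤ n) (hg : g ∈ simpleSet n a k) :
    ∃ (s : Finset ℕ) (l : List (Finset ℕ)), k ∈ s ∧
      (∀ u ∈ s :: l, u.Nonempty ∧ u ⊆ Finset.Icc a k) ∧ (s :: l).Pairwise NonCross ∧
      g = descCycle n s * (l.map (descCycle n)).prod := by
  obtain ⟨l, hl, hp, rfl⟩ := hg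
  by_cases hks : ∃ s ∈ l, k ∈ s
  · obtain ⟨s, hs, hks⟩ := hks
    have hperm := List.perm_cons_erase hs
    refine ⟨s, l.erase s, hks, fun u hu => hl u (hperm.symm.subset hu),
      (hperm.pairwise_iff fun h => h.symm).1 hp, ?_⟩
    rw [← List.prod_cons, ← List.map_cons]
    exact (hperm.map _).prod_eq' (pairwise_commute (fun u hu =>
      (hl u hu).2.trans (Finset.Icc_subset_Icc ha hk)) hp)
  · push Not at hks
    refine ⟨{k}, l, by simp, ?_, ?_, by rw [descCycle_singleton, one_mul]⟩
    · intro u hu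
      rcases List.mem_cons.1 hu with rfl | hu
      · simpa using hak
      · exact hl u hu
    · exact List.pairwise_cons.2 ⟨fun u hu => nonCross_singleton (hks u hu), hp⟩

/-- If `k` is the top strand of a simple element, then multiplication by the arc from `k` to a
larger strand `b + 1` inserts `b + 1` into the cycle of `k`. -/
theorem band_mul_mem_simpleSet {n a b k : ℕ} {g g' : BraidGroup n} (ha : 1 ≤ a) (hak : a ≤ k)
    (hkb : k ≤ b) (hb : b + 1 ≤ n) (hg : g ∈ simpleSet n a k) (hg' : g' ∈ simpleSet n (k + 1) b) :
    band n (b + 1) k * g * g' ∈ simpleSet n a (b + 1) := by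
  obtain ⟨s, l, hks, hl, hp, rfl⟩ := exists_cons_of_mem_simpleSet ha hak (by omega) hg
  obtain ⟨l', hl', hp', rfl⟩ := hg'
  have hsk : ∀ u ∈ s :: l, ∀ x ∈ u, a ≤ x ∧ x ≤ k := fun u hu x hx =>
    Finset.mem_Icc.1 ((hl u hu).2 hx)
  have hlk : ∀ u ∈ l', ∀ x ∈ u, k + 1 ≤ x ∧ x ≤ b := fun u hu x hx =>
    Finset.mem_Icc.1 ((hl' u hu).2 hx)
  refine ⟨insert (b + 1) s :: (l ++ l'), ?_, ?_, ?_⟩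
  · intro u hu
    rcases List.mem_cons.1 hu with rfl | hu
    · refine ⟨Finset.insert_nonempty _ _, fun x hx => Finset.mem_Icc.2 ?_⟩
      rcases Finset.mem_insert.1 hx with rfl | hx
      · omega
      · have := hsk s (by simp) x hx; omega
    rcases List.mem_append.1 hu with hu | hu
    · refine ⟨(hl u (List.mem_cons_of_mem _ hu)).1, fun x hx => Finset.mem_Icc.2 ?_⟩
      have := hsk u (List.mem_cons_of_mem _ hu) x hx; omega
    · refine ⟨(hl' u hu).1, fun x hx => Finset.mem_Icc.2 ?_⟩
      have := hlk u hu x hx; omega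
  · rw [List.pairwise_cons] at hp ⊢
    refine ⟨fun u hu => ?_, List.pairwise_append.2 ⟨hp.2, hp', fun u hu v hv =>
      nonCross_of_lt fun x hx y hy => ?_⟩⟩
    · rcases List.mem_append.1 hu with hu | hu
      · exact (hp.1 u hu).insert_of_le hks (by omega) fun x hx =>
          (hsk u (List.mem_cons_of_mem _ hu) x hx).2
      · exact nonCross_insert_of_between (fun x hx => (hsk s (by simp) x hx).2) fun x hx => by
          have := hlk u hu x hx; omega
    · have := hsk u (List.mem_cons_of_mem _ hu) x hx
      have := hlk v hv y hy
      omega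
  · rw [List.map_cons, List.prod_cons, List.map_append, List.prod_append,
      descCycle_insert n hks (fun x hx => (hsk s (by simp) x hx).2) (by omega)]
    simp only [mul_assoc]

/-! ### Spanning by simple elements -/

/-- Each product that starts with an arc is, inductively, a combination of products of the shape
treated in `band_mul_mem_simpleSet`. -/
theorem IsTLHom.mem_span_simpleSet {n : ℕ} {A : Type*} [Ring A] [Algebra ℂ A] {t : ℂ}
    {π : BraidGroup n →* A} (hπ : IsTLHom t π) {a b : ℕ} (ha : 1 ≤ a) (hb : b ≤ n) {x : A}
    (hx : x ∈ stdAlg π a b) : x ∈ Submodule.span ℂ (π '' simpleSet n a b) := by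
  obtain ⟨d, hd⟩ : ∃ d, d = b - a := ⟨_, rfl⟩
  induction d using Nat.strong_induction_on generalizing a b x with
  | _ d ih =>
    rcases le_or_gt b a with hab | hab
    · have he : Set.Ico a b = ∅ := Set.Ico_eq_empty (by omega)
      have hbot : stdAlg π a b = ⊥ := by
        unfold stdAlg
        simp only [he, Set.image_empty, Algebra.adjoin_empty]
      obtain ⟨r, rfl⟩ := Algebra.mem_bot.1 (hbot ▸ hx)
      rw [Algebra.algebraMap_eq_smul_one]
      exact Submodule.smul_mem _ _ (Submodule.subset_span ⟨1, one_mem_simpleSet n a b, map_one π⟩)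
    · obtain ⟨b, rfl⟩ : ∃ b', b = b' + 1 := ⟨b - 1, by omega⟩
      refine Submodule.span_le.2 ?_ (hπ.mem_span_arcSet ha hab.le hb hx)
      rintro _ (hz | ⟨k, x, y, hak, hkb, hx, hy, rfl⟩)
      · exact Submodule.span_mono (Set.image_mono (simpleSet_mono (Nat.le_succ b)))
          (ih (b - a) (by omega) ha (by omega) hz rfl)
      · have hx' := ih (k - a) (by omega) ha (by omega) hx rfl
        have hy' := ih (b - (k + 1)) (by omega) (by omega) (by omega) hy rfl
        refine mul_mul_mem_of_mem_span _ _ hx' ?_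
        rintro _ ⟨g, hg, rfl⟩
        rw [← mul_one (π (band n (b + 1) k) * π g * y)]
        refine mul_mul_mem_of_mem_span _ _ hy' ?_
        rintro _ ⟨g', hg', rfl⟩
        rw [mul_one, ← map_mul, ← map_mul]
        exact Submodule.subset_span ⟨_, band_mul_mem_simpleSet ha hak (by omega) hb hg hg', rfl⟩

/-- The flip relation for `π(σᵢ₊₁)` and `π(σᵢ)` amounts to the vanishing of the antisymmetrizer on
three strands. -/
theorem isTLHom_braidToTL (n : ℕ) (τ t : ℂ) (hτ : τ ≠ 0) (ht : t ≠ 0) (hτt : τ⁻¹ = 2 + t + t⁻¹) :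
    IsTLHom t (braidToTL n τ t hτ ht hτt) := by
  have hquad : ∀ m, 1 ≤ m → m < n → braidToTL n τ t hτ ht hτt (sigma n m) *
      braidToTL n τ t hτ ht hτt (sigma n m) =
      (t - 1) • braidToTL n τ t hτ ht hτt (sigma n m) + t • (1 : TL n τ) := fun m h1 h2 => by
    rw [braidToTL_sigma n τ t hτ ht hτt ⟨m, h1, h2⟩, h_sq]
  refine ⟨ht, hquad, fun m h1 h2 => ?_⟩
  have hu := hquad (m + 1) (by omega) h2
  have eu := braidToTL_sigma n τ t hτ ht hτt ⟨m + 1, by omega, h2⟩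
  have ev := braidToTL_sigma n τ t hτ ht hτt ⟨m, h1, by omega⟩
  unfold FlipRel
  set π := braidToTL n τ t hτ ht hτt
  simp only at eu ev
  have key := sq_mul_tau hτ ht hτt
  have hanti : π (sigma n (m + 1)) * π (sigma n m) * π (sigma n (m + 1))
      + π (sigma n (m + 1)) * π (sigma n m) + π (sigma n m) * π (sigma n (m + 1))
      + π (sigma n (m + 1)) + π (sigma n m) + 1 = 0 := by
    rw [eu, ev]
    simp only [h, sub_mul, mul_sub, smul_mul_assoc, mul_smul_comm, e_idem,
      e_down ⟨m + 1, by omega, h2⟩ ⟨m, h1, by omega⟩ rfl, one_mul, mul_one]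
    match_scalars <;> first
      | linear_combination (t + 1) * key
      | ring1
  have hw : π (sigma n (m + 1) * sigma n m * (sigma n (m + 1))⁻¹) * π (sigma n (m + 1))
      = π (sigma n (m + 1)) * π (sigma n m) := by
    rw [← map_mul, ← map_mul]; congr 1; group
  have hinv : π (sigma n (m + 1)) * π (sigma n (m + 1))⁻¹ = 1 := by
    rw [← map_mul, mul_inv_cancel, map_one]
  set w := π (sigma n (m + 1) * sigma n m * (sigma n (m + 1))⁻¹)
  set u := π (sigma n (m + 1))
  set v := π (sigma n m)
  have : (v * u + t • (u * v) + t • w + u + v + 1) * u = 0 := by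
    have e : (v * u + t • (u * v) + t • w + u + v + 1) * u
        = v * (u * u) + t • (u * v * u) + t • (w * u) + u * u + v * u + u := by
      simp only [add_mul, smul_mul_assoc, one_mul, mul_assoc]
    rw [e, hw, hu, ← smul_zero t, ← hanti]
    simp only [mul_add, mul_smul_comm, mul_one]
    module
  calc _ = (v * u + t • (u * v) + t • w + u + v + 1) * (u * π (sigma n (m + 1))⁻¹) := by
        rw [hinv, mul_one]
    _ = 0 := by rw [← mul_assoc, this, zero_mul]

/-- The images of the simple elements span the Temperley-Lieb algebra. -/
theorem span_simpleElements (n : ℕ) (τ t : ℂ) (hτ : τ ≠ 0) (ht : t ≠ 0)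
    (hτt : τ⁻¹ = 2 + t + t⁻¹) :
    Submodule.span ℂ (braidToTL n τ t hτ ht hτt '' simpleElements n) = ⊤ := by
  rw [eq_top_iff]
  rintro x -
  rw [← simpleSet_eq_simpleElements]
  refine (isTLHom_braidToTL n τ t hτ ht hτt).mem_span_simpleSet le_rfl le_rfl ?_
  have ht1 : t + 1 ≠ 0 := by
    intro h0
    have := sq_mul_tau hτ ht hτt
    rw [h0] at this
    exact ht (by rw [← this]; ring)
  obtain ⟨y, rfl⟩ := RingQuot.mkAlgHom_surjective ℂ (TLRel n τ) x
  induction y using FreeAlgebra.induction with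
  | grade0 r => rw [AlgHom.commutes]; exact Subalgebra.algebraMap_mem _ r
  | grade1 i =>
    have he : RingQuot.mkAlgHom ℂ (TLRel n τ) (FreeAlgebra.ι ℂ i)
        = (t + 1)⁻¹ • (braidToTL n τ t hτ ht hτt (sigma n i) + 1) := by
      rw [braidToTL_sigma, h, sub_add_cancel, smul_smul, inv_mul_cancel₀ ht1, one_smul, e]
    rw [he]
    exact Subalgebra.smul_mem _ (add_mem (sigma_mem_stdAlg _ i.2.1 i.2.2) (one_mem _)) _
  | mul x y hx hy => rw [map_mul]; exact mul_mem hx hy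
  | add x y hx hy => rw [map_add]; exact add_mem hx hy

/-! ### The representation on states, and its top matrix entries -/

/-- A state `ℕ → Bool` says which of the sites are occupied. This one is obtained from `x` by
exchanging the contents of the sites `i` and `j`. -/
def exch (i j : ℕ) (x : ℕ → Bool) : ℕ → Bool := x ∘ Equiv.swap i j

theorem exch_left (i j : ℕ) (x : ℕ → Bool) : exch i j x i = x j := by simp [exch]

theorem exch_right (i j : ℕ) (x : ℕ → Bool) : exch i j x j = x i := by simp [exch]

theorem exch_of_ne {i j m : ℕ} (x : ℕ → Bool) (hi : m ≠ i) (hj : m ≠ j) :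
    exch i j x m = x m := by simp [exch, Equiv.swap_apply_of_ne_of_ne hi hj]

theorem exch_exch (i j : ℕ) (x : ℕ → Bool) : exch i j (exch i j x) = x := by
  funext m; simp [exch]

theorem exch_comm {i j k l : ℕ} (x : ℕ → Bool) (hik : i ≠ k) (hil : i ≠ l) (hjk : j ≠ k)
    (hjl : j ≠ l) : exch i j (exch k l x) = exch k l (exch i j x) := by
  funext m
  by_cases h1 : m = i
  · subst h1; rw [exch_left, exch_of_ne _ hjk hjl, exch_of_ne _ hik hil, exch_left]
  by_cases h2 : m = j
  · subst h2; rw [exch_right, exch_of_ne _ hik hil, exch_of_ne _ hjk hjl, exch_right]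
  by_cases h3 : m = k
  · subst h3; rw [exch_of_ne _ h1 h2, exch_left, exch_left, exch_of_ne _ hil.symm hjl.symm]
  by_cases h4 : m = l
  · subst h4; rw [exch_of_ne _ h1 h2, exch_right, exch_right, exch_of_ne _ hik.symm hjk.symm]
  rw [exch_of_ne _ h1 h2, exch_of_ne _ h3 h4, exch_of_ne _ h3 h4, exch_of_ne _ h1 h2]

/-- The functions on the states; up to transposition, the tensor space on which the Temperley-Lieb
algebra acts. -/
abbrev StateFun : Type := (ℕ → Bool) → ℂ

/-- The weights `1 / (1 + t)` and `t / (1 + t)`; their sum is `1` and their product is `τ`. -/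
def weight (t : ℂ) (b : Bool) : ℂ := if b then (t + 1)⁻¹ else t * (t + 1)⁻¹

/-- The action of `eₘ` on functions on states: an idempotent of rank one at the sites `m`
and `m + 1`. -/
def tlGen (t : ℂ) (m : ℕ) : Module.End ℂ StateFun where
  toFun φ x := if x m = x (m + 1) then 0 else weight t (x m) * (φ x + φ (exch m (m + 1) x))
  map_add' φ ψ := by
    funext x
    simp only [Pi.add_apply]
    split_ifs <;> ring
  map_smul' c φ := by
    funext x
    simp only [Pi.smul_apply, smul_eq_mul, RingHom.id_apply]
    split_ifs <;> ring

theorem tlGen_apply (t : ℂ) (m : ℕ) (φ : StateFun) (x : ℕ → Bool) :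
    tlGen t m φ x = if x m = x (m + 1) then 0 else
      weight t (x m) * (φ x + φ (exch m (m + 1) x)) := rfl

section Relations

variable {τ t : ℂ}

theorem tlGen_idem (ht1 : t + 1 ≠ 0) (m : ℕ) : tlGen t m * tlGen t m = tlGen t m := by
  ext φ x
  simp only [Module.End.mul_apply, tlGen_apply, exch_left, exch_right, exch_exch]
  cases x m <;> cases x (m + 1) <;> simp [weight, -mul_eq_mul_left_iff] <;> field_simp <;> ring

theorem tlGen_up (hτ : (t + 1) ^ 2 * τ = t) (ht1 : t + 1 ≠ 0) (m : ℕ) :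
    tlGen t m * tlGen t (m + 1) * tlGen t m = τ • tlGen t m := by
  obtain rfl : τ = t / (t + 1) ^ 2 := by field_simp; linear_combination hτ
  ext φ x
  have e1 (y : ℕ → Bool) : exch m (m + 1) y (m + 1 + 1) = y (m + 1 + 1) :=
    exch_of_ne y (by omega) (by omega)
  have e2 (y : ℕ → Bool) : exch (m + 1) (m + 1 + 1) y m = y m :=
    exch_of_ne y (by omega) (by omega)
  simp only [Module.End.mul_apply, tlGen_apply, exch_left, exch_right, exch_exch, e1, e2,
    LinearMap.smul_apply, Pi.smul_apply, smul_eq_mul]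
  cases x m <;> cases x (m + 1) <;> cases x (m + 1 + 1) <;> simp [weight] <;> field_simp <;> ring

theorem tlGen_down (hτ : (t + 1) ^ 2 * τ = t) (ht1 : t + 1 ≠ 0) (m : ℕ) :
    tlGen t (m + 1) * tlGen t m * tlGen t (m + 1) = τ • tlGen t (m + 1) := by
  obtain rfl : τ = t / (t + 1) ^ 2 := by field_simp; linear_combination hτ
  ext φ x
  have e1 (y : ℕ → Bool) : exch m (m + 1) y (m + 1 + 1) = y (m + 1 + 1) :=
    exch_of_ne y (by omega) (by omega)
  have e2 (y : ℕ → Bool) : exch (m + 1) (m + 1 + 1) y m = y m :=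
    exch_of_ne y (by omega) (by omega)
  simp only [Module.End.mul_apply, tlGen_apply, exch_left, exch_right, exch_exch, e1, e2,
    LinearMap.smul_apply, Pi.smul_apply, smul_eq_mul]
  cases x m <;> cases x (m + 1) <;> cases x (m + 1 + 1) <;> simp [weight] <;> field_simp <;> ring

theorem tlGen_comm {i j : ℕ} (hij : i + 2 ≤ j) : tlGen t i * tlGen t j = tlGen t j * tlGen t i := by
  ext φ x
  have e1 (y : ℕ → Bool) : exch i (i + 1) y j = y j := exch_of_ne y (by omega) (by omega)
  have e2 (y : ℕ → Bool) : exch i (i + 1) y (j + 1) = y (j + 1) :=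
    exch_of_ne y (by omega) (by omega)
  have e3 (y : ℕ → Bool) : exch j (j + 1) y i = y i := exch_of_ne y (by omega) (by omega)
  have e4 (y : ℕ → Bool) : exch j (j + 1) y (i + 1) = y (i + 1) :=
    exch_of_ne y (by omega) (by omega)
  have e5 : exch j (j + 1) (exch i (i + 1) x) = exch i (i + 1) (exch j (j + 1) x) :=
    exch_comm x (by omega) (by omega) (by omega) (by omega)
  simp only [Module.End.mul_apply, tlGen_apply, e1, e2, e3, e4, e5]
  split_ifs <;> ring

end Relations

/-- The representation of the Temperley-Lieb algebra on functions on states. -/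
def stateRep (n : ℕ) {τ t : ℂ} (hτ : (t + 1) ^ 2 * τ = t) (ht1 : t + 1 ≠ 0) :
    TL n τ →ₐ[ℂ] Module.End ℂ StateFun :=
  RingQuot.liftAlgHom ℂ ⟨FreeAlgebra.lift ℂ fun i : Set.Ico 1 n => tlGen t i, by
    rintro _ _ (⟨i, j, hij⟩ | ⟨i⟩ | ⟨i, j, hij⟩ | ⟨i, j, hij⟩)
    · simp only [map_mul, FreeAlgebra.lift_ι_apply]
      rcases le_abs.1 hij with hij | hij
      · exact (tlGen_comm (by omega)).symm
      · exact tlGen_comm (by omega)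
    · simpa only [map_mul, FreeAlgebra.lift_ι_apply] using tlGen_idem ht1 i
    · simp only [map_mul, map_smul, FreeAlgebra.lift_ι_apply, hij]
      exact tlGen_up hτ ht1 i
    · simp only [map_mul, map_smul, FreeAlgebra.lift_ι_apply, hij]
      exact tlGen_down hτ ht1 j⟩

theorem stateRep_e (n : ℕ) {τ t : ℂ} (hτ : (t + 1) ^ 2 * τ = t) (ht1 : t + 1 ≠ 0)
    (i : Set.Ico 1 n) : stateRep n hτ ht1 (e n τ i) = tlGen t i := by
  simp [stateRep, e]

/-- The sum of the positions of the occupied sites among `0, …, n`. -/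
def degree (n : ℕ) (x : ℕ → Bool) : ℕ := ∑ m ∈ Finset.range (n + 1), if x m then m else 0

theorem degree_exch {n m : ℕ} {x : ℕ → Bool} (hm : m < n) (h1 : x m = true)
    (h2 : x (m + 1) = false) : degree n (exch m (m + 1) x) = degree n x + 1 := by
  have h1m : m ∈ Finset.range (n + 1) := Finset.mem_range.2 (by omega)
  have h2m : m + 1 ∈ (Finset.range (n + 1)).erase m :=
    Finset.mem_erase.2 ⟨by omega, Finset.mem_range.2 (by omega)⟩
  unfold degree
  rw [← Finset.add_sum_erase _ _ h1m, ← Finset.add_sum_erase _ _ h2m,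
    ← Finset.add_sum_erase (Finset.range (n + 1)) (fun m => if x m then m else 0) h1m,
    ← Finset.add_sum_erase _ (fun m => if x m then m else 0) h2m, exch_left, exch_right, h1, h2]
  have : ∀ k ∈ ((Finset.range (n + 1)).erase m).erase (m + 1),
      (if exch m (m + 1) x k then k else 0) = if x k then k else 0 := fun k hk => by
    rw [Finset.mem_erase, Finset.mem_erase] at hk
    rw [exch_of_ne x hk.2.1 hk.1]
  rw [Finset.sum_congr rfl this]
  simp; omega

/-- The matrix entries of `T` in row `x` raise the degree by at most `d`, and there is at most one
entry that raises it by exactly `d`: the entry `c x` in column `f x`. -/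
structure HasTop (n : ℕ) (T : Module.End ℂ StateFun) (d : ℕ) (c : (ℕ → Bool) → ℂ)
    (f : (ℕ → Bool) → ℕ → Bool) : Prop where
  degree_eq : ∀ x, c x ≠ 0 → degree n (f x) = degree n x + d
  apply_eq : ∀ x φ, (∀ y, degree n y < degree n x + d → φ y = 0) → T φ x = c x * φ (f x)

namespace HasTop

variable {n d d' : ℕ} {T T' : Module.End ℂ StateFun} {c c' : (ℕ → Bool) → ℂ}
  {f f' : (ℕ → Bool) → ℕ → Bool}

theorem one (n : ℕ) : HasTop n 1 0 (fun _ => 1) id := ⟨by simp, by simp⟩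

/-- In a degree above its own, an operator has no top entries. -/
theorem of_lt (hT : HasTop n T d c f) (hd : d < d') : HasTop n T d' (fun _ => 0) f' := by
  refine ⟨by simp, fun x φ hφ => ?_⟩
  rw [hT.apply_eq x φ fun y hy => hφ y (by omega), zero_mul]
  by_cases hc : c x = 0
  · rw [hc, zero_mul]
  · rw [hφ _ (by rw [hT.degree_eq x hc]; omega), mul_zero]

theorem congr (hT : HasTop n T d c f) (hf : ∀ x, c x ≠ 0 → f x = f' x) : HasTop n T d c f' := by
  refine ⟨fun x hc => hf x hc ▸ hT.degree_eq x hc, fun x φ hφ => ?_⟩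
  rw [hT.apply_eq x φ hφ]
  by_cases hc : c x = 0
  · rw [hc, zero_mul, zero_mul]
  · rw [hf x hc]

theorem add (hT : HasTop n T d c f) (hT' : HasTop n T' d c' f) :
    HasTop n (T + T') d (fun x => c x + c' x) f := by
  refine ⟨fun x hc => ?_, fun x φ hφ => ?_⟩
  · by_cases h0 : c x = 0
    · exact hT'.degree_eq x fun h0' => hc (by rw [h0, h0', add_zero])
    · exact hT.degree_eq x h0
  · rw [LinearMap.add_apply, Pi.add_apply, hT.apply_eq x φ hφ, hT'.apply_eq x φ hφ, add_mul]

theorem smul (hT : HasTop n T d c f) (r : ℂ) : HasTop n (r • T) d (fun x => r * c x) f := by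
  refine ⟨fun x hc => hT.degree_eq x (right_ne_zero_of_mul hc), fun x φ hφ => ?_⟩
  rw [LinearMap.smul_apply, Pi.smul_apply, smul_eq_mul, hT.apply_eq x φ hφ, mul_assoc]

/-- Operators act on functions, so the top column of a product is found by following the left
factor first. -/
theorem mul (hT : HasTop n T d c f) (hT' : HasTop n T' d' c' f') :
    HasTop n (T * T') (d + d') (fun x => c x * c' (f x)) (f' ∘ f) := by
  refine ⟨fun x hc => ?_, fun x φ hφ => ?_⟩
  · rw [Function.comp, hT'.degree_eq _ (right_ne_zero_of_mul hc),
      hT.degree_eq _ (left_ne_zero_of_mul hc), add_assoc]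
  · rw [Module.End.mul_apply, hT.apply_eq x]
    · by_cases hc : c x = 0
      · simp [hc]
      · rw [hT'.apply_eq _ φ fun y hy => hφ y (by rw [hT.degree_eq x hc] at hy; omega), mul_assoc]
        rfl
    · intro y hy
      rw [hT'.apply_eq y φ fun z hz => hφ z (by omega)]
      by_cases hc : c' y = 0
      · rw [hc, zero_mul]
      · rw [hφ _ (by rw [hT'.degree_eq y hc]; omega), mul_zero]

theorem tlGen {t : ℂ} {m : ℕ} (hm : m < n) : HasTop n (tlGen t m) 1
    (fun x => if x m = true ∧ x (m + 1) = false then (t + 1)⁻¹ else 0) (exch m (m + 1)) := by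
  refine ⟨fun x hc => ?_, fun x φ hφ => ?_⟩
  · have hx : x m = true ∧ x (m + 1) = false := by
      by_contra hx
      exact hc (if_neg hx)
    exact degree_exch hm hx.1 hx.2
  · rw [tlGen_apply]
    have h0 : φ x = 0 := hφ x (by omega)
    cases h1 : x m <;> cases h2 : x (m + 1)
    · simp
    · have : degree n x = degree n (exch m (m + 1) x) + 1 := by
        rw [← degree_exch hm (by rw [exch_left, h2]) (by rw [exch_right, h1]), exch_exch]
      simp [h0, hφ (exch m (m + 1) x) (by omega)]
    · simp [h0, weight]
    · simp

end HasTop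

section Top

variable {n : ℕ} {τ t : ℂ} {π : BraidGroup n →* Module.End ℂ StateFun}

/-- In top degree `a_{ji}` moves a particle from site `i` to the empty site `j`, over whatever is in
between. -/
theorem exists_hasTop_band (hπ : IsTLHom t π)
    (hσ : ∀ m, 1 ≤ m → m < n → π (sigma n m) = (t + 1) • tlGen t m - 1) (ht1 : t + 1 ≠ 0)
    {i j : ℕ} (hi : 1 ≤ i) (hij : i < j) (hj : j ≤ n) :
    ∃ c : (ℕ → Bool) → ℂ, (∀ x, c x ≠ 0 ↔ x i = true ∧ x j = false) ∧
      HasTop n (π (band n j i)) (j - i) c (exch i j) := by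
  have hgen : ∀ m, 1 ≤ m → m < n → HasTop n (π (sigma n m)) 1
      (fun x => if x m = true ∧ x (m + 1) = false then 1 else 0) (exch m (m + 1)) := by
    intro m h1 h2
    have h := ((HasTop.tlGen (t := t) h2).smul (t + 1)).add
      (((HasTop.one n).smul (-1)).of_lt (d' := 1) (f' := exch m (m + 1)) one_pos)
    rw [hσ m h1 h2, sub_eq_add_neg, ← neg_one_smul ℂ (1 : Module.End ℂ StateFun)]
    convert h using 2 with x
    split_ifs <;> simp [ht1]
  induction j, hij using Nat.le_induction with
  | base =>
    refine ⟨_, fun x => ?_, by rw [band_succ_self, Nat.succ_sub le_rfl, Nat.sub_self]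
                               exact hgen i hi hj⟩
    simp
  | succ j hij ih =>
    obtain ⟨c, hc, hT⟩ := ih (by omega)
    have hij : i < j := hij
    have hs := hgen j (by omega) (by omega)
    have hrel := hπ.flip_sigma_band hi hij (by omega)
    unfold FlipRel at hrel
    rw [← band_succ hij] at hrel
    have hd1 : j - i + 1 = j + 1 - i := by omega
    have hd2 : 1 + (j - i) = j + 1 - i := by omega
    have h1 : HasTop n (π (band n j i) * π (sigma n j)) (j + 1 - i)
        (fun x => c x * if exch i j x j = true ∧ exch i j x (j + 1) = false then 1 else 0)
        (exch i (j + 1)) := by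
      have := hT.mul hs
      rw [hd1] at this
      refine this.congr fun x hx => ?_
      have hx1 := (hc x).1 (left_ne_zero_of_mul hx)
      have hx2 : exch i j x j = true ∧ exch i j x (j + 1) = false := by
        by_contra h0
        exact hx (by simp only [if_neg h0, mul_zero])
      rw [exch_of_ne (m := j + 1) x (by omega) (by omega)] at hx2
      funext m
      by_cases e1 : m = i
      · subst e1
        rw [Function.comp, exch_of_ne _ (by omega) (by omega), exch_left, exch_left, hx1.2, hx2.2]
      by_cases e2 : m = j
      · subst e2
        rw [Function.comp, exch_left, exch_of_ne _ (by omega) (by omega),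
          exch_of_ne _ (by omega) (by omega), hx1.2, hx2.2]
      by_cases e3 : m = j + 1
      · subst e3
        rw [Function.comp, exch_right, exch_right, exch_right]
      rw [Function.comp, exch_of_ne _ e2 e3, exch_of_ne _ e1 e2, exch_of_ne _ e1 e3]
    have h2 : HasTop n (π (sigma n j) * π (band n j i)) (j + 1 - i)
        (fun x => (if x j = true ∧ x (j + 1) = false then 1 else 0) * c (exch j (j + 1) x))
        (exch i (j + 1)) := by
      have := hs.mul hT
      rw [hd2] at this
      refine this.congr fun x hx => ?_
      have hx1 := (hc _).1 (right_ne_zero_of_mul hx)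
      have hx2 : x j = true ∧ x (j + 1) = false := by
        by_contra h0
        exact hx (by simp only [if_neg h0, zero_mul])
      rw [exch_of_ne x (by omega) (by omega)] at hx1
      funext m
      by_cases e1 : m = i
      · subst e1
        rw [Function.comp, exch_left, exch_left, exch_left]
      by_cases e2 : m = j
      · subst e2
        rw [Function.comp, exch_right, exch_of_ne _ (by omega) (by omega),
          exch_of_ne _ (by omega) (by omega), hx1.1, hx2.1]
      by_cases e3 : m = j + 1
      · subst e3
        rw [Function.comp, exch_of_ne _ (by omega) (by omega), exch_right, exch_right, hx1.1, hx2.1]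
      rw [Function.comp, exch_of_ne _ e1 e2, exch_of_ne _ e2 e3, exch_of_ne _ e1 e3]
    have h3 : HasTop n (π (sigma n j)) (j + 1 - i) (fun _ => 0) (exch i (j + 1)) :=
      hs.of_lt (by omega)
    have h4 : HasTop n (π (band n j i)) (j + 1 - i) (fun _ => 0) (exch i (j + 1)) :=
      hT.of_lt (by omega)
    have h5 : HasTop n 1 (j + 1 - i) (fun _ => 0) (exch i (j + 1)) :=
      (HasTop.one n).of_lt (by omega)
    have hw : π (band n (j + 1) i) = (-t⁻¹) • (π (band n j i) * π (sigma n j)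
        + t • (π (sigma n j) * π (band n j i)) + π (sigma n j) + π (band n j i) + 1) := by
      have : t • π (band n (j + 1) i) = -(π (band n j i) * π (sigma n j)
          + t • (π (sigma n j) * π (band n j i)) + π (sigma n j) + π (band n j i) + 1) := by
        rw [← sub_eq_zero, ← hrel]; abel
      have h0 := congrArg (fun z => t⁻¹ • z) this
      simp only [smul_smul, inv_mul_cancel₀ hπ.ne_zero, one_smul] at h0
      rw [h0]
      module
    rw [hw]
    refine ⟨_, fun x => ?_, ((((h1.add (h2.smul t)).add h3).add h4).add h5).smul (-t⁻¹)⟩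
    have ht : t ≠ 0 := hπ.ne_zero
    have e1 : exch i j x (j + 1) = x (j + 1) := exch_of_ne x (by omega) (by omega)
    have e2 : exch j (j + 1) x i = x i := exch_of_ne x (by omega) (by omega)
    have c1 := hc x
    have c2 := hc (exch j (j + 1) x)
    rw [exch_left, e2] at c2
    rw [exch_right, e1]
    -- the site `j` is either empty or occupied, and exactly one of the two products contributes
    cases hxi : x i <;> cases hxj : x j <;> cases hxj1 : x (j + 1) <;>
      simp [hxi, hxj, hxj1] at c1 c2 ⊢ <;> simp [c1, c2, ht]

end Top

/-! ### Top entries of products of descending cycles -/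

/-- `m` is not the largest element of `s` (for `m ∈ s`). -/
def HasAbove (s : Finset ℕ) (m : ℕ) : Prop := ∃ k ∈ s, m < k

/-- `m` is not the smallest element of `s` (for `m ∈ s`). -/
def HasBelow (s : Finset ℕ) (m : ℕ) : Prop := ∃ k ∈ s, k < m

/-- On `s`, the state `x` is the indicator of the elements other than the largest one; there is no
condition if `s` is a singleton. -/
def Fits (s : Finset ℕ) (x : ℕ → Bool) : Prop :=
  ∀ m ∈ s, (HasAbove s m → x m = true) ∧ (HasBelow s m → ¬ HasAbove s m → x m = false)

/-- On `s`, the state `y` is the indicator of the elements other than the smallest one, or agrees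
with `x` if `s` is a singleton. -/
def ShiftedOn (s : Finset ℕ) (x y : ℕ → Bool) : Prop :=
  ∀ m ∈ s, (HasBelow s m → y m = true) ∧ (HasAbove s m → ¬ HasBelow s m → y m = false) ∧
    (¬ HasAbove s m → ¬ HasBelow s m → y m = x m)

theorem fits_congr {s : Finset ℕ} {x x' : ℕ → Bool} (h : ∀ m ∈ s, x' m = x m) :
    Fits s x' ↔ Fits s x := by
  unfold Fits
  refine forall₂_congr fun m hm => ?_
  rw [h m hm]

section Tops

variable {n : ℕ} {π : BraidGroup n →* Module.End ℂ StateFun}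

/-- In top degree, the cycle on `i₁ > ⋯ > iₖ` moves a particle from `i₂` to the empty site `i₁`,
then one from `i₃` to `i₂`, and so on, so that particles at all elements but the largest one become
particles at all elements but the smallest one. -/
theorem exists_hasTop_descCycle
    (hband : ∀ i j, 1 ≤ i → i < j → j ≤ n → ∃ c : (ℕ → Bool) → ℂ,
      (∀ x, c x ≠ 0 ↔ x i = true ∧ x j = false) ∧
        HasTop n (π (band n j i)) (j - i) c (exch i j))
    {s : Finset ℕ} (hs : s ⊆ Finset.Icc 1 n) :
    ∃ d c f, HasTop n (π (descCycle n s)) d c f ∧ ∀ x, (c x ≠ 0 ↔ Fits s x) ∧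
      (c x ≠ 0 → ShiftedOn s x (f x) ∧ ∀ m ∉ s, f x m = x m) := by
  induction s using Finset.induction_on_max with
  | empty =>
    refine ⟨0, fun _ => 1, id, ?_,
      fun x => ⟨by simp [Fits], fun _ => ⟨by simp [ShiftedOn], by simp⟩⟩⟩
    rw [show descCycle n ∅ = 1 by simp [descCycle, cycleProd], map_one]
    exact HasTop.one n
  | insert b s hb ih =>
    rcases s.eq_empty_or_nonempty with rfl | hne
    · refine ⟨0, fun _ => 1, id, ?_, fun x => ⟨?_, fun _ => ⟨?_, by simp⟩⟩⟩
      · rw [insert_empty_eq, descCycle_singleton, map_one]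
        exact HasTop.one n
      · simp [Fits, HasAbove, HasBelow]
      · simp [ShiftedOn, HasAbove, HasBelow]
    have hsn : s ⊆ Finset.Icc 1 n := (Finset.subset_insert b s).trans hs
    obtain ⟨d, c, f, hT, hcf⟩ := ih hsn
    set k := s.max' hne with hk
    have hks : k ∈ s := s.max'_mem hne
    have hsk : ∀ x ∈ s, x ≤ k := fun x hx => s.le_max' x hx
    have hkb : k < b := hb k hks
    have hbs : b ∉ s := fun h => lt_irrefl b (hb b h)
    obtain ⟨c₁, hc₁, hT₁⟩ := hband k b (Finset.mem_Icc.1 (hsn hks)).1 hkb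
      (Finset.mem_Icc.1 (hs (Finset.mem_insert_self b s))).2
    have hA : ∀ m ∈ s, HasAbove (insert b s) m := fun m hm =>
      ⟨b, Finset.mem_insert_self b s, hb m hm⟩
    have hAb : ¬ HasAbove (insert b s) b := by
      rintro ⟨m, hm, hbm⟩
      rcases Finset.mem_insert.1 hm with rfl | hm
      · exact lt_irrefl _ hbm
      · exact lt_asymm hbm (hb m hm)
    have hBb : HasBelow (insert b s) b := ⟨k, Finset.mem_insert_of_mem hks, hkb⟩
    have hBs : ∀ m ∈ s, HasBelow (insert b s) m ↔ HasBelow s m := by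
      refine fun m hm => ⟨?_, fun ⟨j, hj, hjm⟩ => ⟨j, Finset.mem_insert_of_mem hj, hjm⟩⟩
      rintro ⟨j, hj, hjm⟩
      rcases Finset.mem_insert.1 hj with rfl | hj
      · exact absurd hjm (lt_asymm (hb m hm))
      · exact ⟨j, hj, hjm⟩
    have hAk : ¬ HasAbove s k := fun ⟨j, hj, hkj⟩ => absurd (hsk j hj) (not_le.2 hkj)
    have hAs : ∀ m ∈ s, m ≠ k → HasAbove s m := fun m hm hmk =>
      ⟨k, hks, lt_of_le_of_ne (hsk m hm) hmk⟩
    refine ⟨_, _, _, by rw [descCycle_insert n hks hsk hkb, map_mul]; exact hT₁.mul hT,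
      fun x => ?_⟩
    have hx'k : exch k b x k = x b := exch_left k b x
    have hx'b : exch k b x b = x k := exch_right k b x
    have hx' : ∀ m, m ≠ k → m ≠ b → exch k b x m = x m := fun m => exch_of_ne x
    rw [mul_ne_zero_iff, hc₁ x, (hcf _).1]
    refine ⟨⟨?_, fun hfit => ⟨⟨?_, ?_⟩, ?_⟩⟩, ?_⟩
    · rintro ⟨⟨hxk, hxb⟩, hfit⟩ m hm
      rcases Finset.mem_insert.1 hm with rfl | hm
      · exact ⟨fun h => absurd h hAb, fun _ _ => hxb⟩
      · refine ⟨fun _ => ?_, fun _ h => absurd (hA m hm) h⟩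
        by_cases hmk : m = k
        · rw [hmk, hxk]
        · rw [← hx' m hmk fun h => hbs (h ▸ hm)]
          exact (hfit m hm).1 (hAs m hm hmk)
    · exact (hfit k (Finset.mem_insert_of_mem hks)).1 (hA k hks)
    · exact (hfit b (Finset.mem_insert_self b s)).2 hBb hAb
    · intro m hm
      by_cases hmk : m = k
      · subst hmk
        exact ⟨fun h => absurd h hAk, fun _ _ => by
          rw [hx'k]; exact (hfit b (Finset.mem_insert_self b s)).2 hBb hAb⟩
      · refine ⟨fun _ => ?_, fun _ h => absurd (hAs m hm hmk) h⟩
        rw [hx' m hmk fun h => hbs (h ▸ hm)]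
        exact (hfit m (Finset.mem_insert_of_mem hm)).1 (hA m hm)
    · rintro ⟨⟨hxk, hxb⟩, hfit⟩
      obtain ⟨hsh, hoff⟩ := (hcf _).2 ((hcf _).1.2 hfit)
      refine ⟨fun m hm => ?_, fun m hm => ?_⟩
      · rcases Finset.mem_insert.1 hm with rfl | hm
        · refine ⟨fun _ => ?_, fun h => absurd h hAb, fun _ h => absurd hBb h⟩
          rw [Function.comp, hoff _ hbs, hx'b, hxk]
        · refine ⟨fun h => (hsh m hm).1 ((hBs m hm).1 h), fun _ h => ?_,
            fun h => absurd (hA m hm) h⟩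
          rw [hBs m hm] at h
          by_cases hmk : m = k
          · subst hmk
            rw [Function.comp, (hsh k hks).2.2 hAk h, hx'k, hxb]
          · exact (hsh m hm).2.1 (hAs m hm hmk) h
      · rw [Finset.mem_insert, not_or] at hm
        rw [Function.comp, hoff m hm.2, hx' m (fun h => hm.2 (h ▸ hks)) hm.1]

/-- Cycles on disjoint sets act on different sites, so their top entries combine independently. -/
theorem exists_hasTop_prod
    (hband : ∀ i j, 1 ≤ i → i < j → j ≤ n → ∃ c : (ℕ → Bool) → ℂ,
      (∀ x, c x ≠ 0 ↔ x i = true ∧ x j = false) ∧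
        HasTop n (π (band n j i)) (j - i) c (exch i j))
    {l : List (Finset ℕ)} (hl : ∀ s ∈ l, s ⊆ Finset.Icc 1 n) (hp : l.Pairwise Disjoint) :
    ∃ d c f, HasTop n (π (l.map (descCycle n)).prod) d c f ∧
      ∀ x, (c x ≠ 0 ↔ ∀ s ∈ l, Fits s x) ∧
        (c x ≠ 0 → (∀ s ∈ l, ShiftedOn s x (f x)) ∧ ∀ m, (∀ s ∈ l, m ∉ s) → f x m = x m) := by
  induction l with
  | nil =>
    refine ⟨0, fun _ => 1, id, ?_, by simp⟩
    rw [List.map_nil, List.prod_nil, map_one]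
    exact HasTop.one n
  | cons s l ih =>
    rw [List.pairwise_cons] at hp
    obtain ⟨d₁, c₁, f₁, hT₁, h₁⟩ := exists_hasTop_descCycle hband (hl s (by simp))
    obtain ⟨d₂, c₂, f₂, hT₂, h₂⟩ := ih (fun u hu => hl u (List.mem_cons_of_mem _ hu)) hp.2
    refine ⟨_, _, _, by rw [List.map_cons, List.prod_cons, map_mul]; exact hT₁.mul hT₂,
      fun x => ?_⟩
    have hoff : c₁ x ≠ 0 → ∀ u ∈ l, ∀ m ∈ u, f₁ x m = x m := fun hc u hu m hm =>
      ((h₁ x).2 hc).2 m fun hms => Finset.disjoint_left.1 (hp.1 u hu) hms hm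
    have hfits : c₁ x ≠ 0 → ((∀ u ∈ l, Fits u (f₁ x)) ↔ ∀ u ∈ l, Fits u x) := fun hc =>
      forall₂_congr fun u hu => fits_congr (hoff hc u hu)
    rw [mul_ne_zero_iff, (h₂ _).1, List.forall_mem_cons, ← (h₁ x).1]
    refine ⟨and_congr_right hfits, fun hc => ?_⟩
    obtain ⟨hs₁, ho₁⟩ := (h₁ x).2 hc.1
    obtain ⟨hs₂, ho₂⟩ := (h₂ _).2 ((h₂ _).1.2 hc.2)
    refine ⟨List.forall_mem_cons.2 ⟨fun m hm => ?_, fun u hu m hm => ?_⟩, fun m hm => ?_⟩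
    · rw [Function.comp, ho₂ m fun u hu hmu => Finset.disjoint_left.1 (hp.1 u hu) hm hmu]
      exact hs₁ m hm
    · rw [← hoff hc.1 u hu m hm]
      exact hs₂ u hu m hm
    · rw [List.forall_mem_cons] at hm
      rw [Function.comp, ho₂ m hm.2, ho₁ m hm.1]

end Tops

/-! ### Non-crossing partitions -/

section Partitions

variable {n : ℕ}

/-- The blocks of a partition, in increasing order of their largest elements. -/
def blockList (P : Finpartition (Finset.Icc 1 n)) : List (Finset ℕ) :=
  ((List.Ico 1 (n + 1)).filter fun k => ∀ m ∈ P.part k, m ≤ k).map P.part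

theorem prod_map_ite_one {α M : Type*} [Monoid M] (p : α → Prop) [DecidablePred p] (g : α → M)
    (l : List α) : (l.map fun k => if p k then g k else 1).prod = ((l.filter p).map g).prod := by
  induction l with
  | nil => rfl
  | cons k l ih =>
    by_cases hk : p k <;> simp [hk, ih]

theorem partitionElement_eq (P : Finpartition (Finset.Icc 1 n)) :
    partitionElement n P = ((blockList P).map (descCycle n)).prod := by
  rw [blockList, List.map_map, partitionElement]
  exact prod_map_ite_one _ _ _

theorem mem_blockList {P : Finpartition (Finset.Icc 1 n)} {s : Finset ℕ} :
    s ∈ blockList P ↔ s ∈ P.parts := by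
  simp only [blockList, List.mem_map, List.mem_filter, List.Ico.mem, decide_eq_true_eq]
  constructor
  · rintro ⟨k, ⟨hk, -⟩, rfl⟩
    exact P.part_mem.2 (Finset.mem_Icc.2 (by omega))
  · intro hs
    have hne := P.nonempty_of_mem_parts hs
    have hmem := s.max'_mem hne
    have hpart := P.part_eq_of_mem hs hmem
    have := Finset.mem_Icc.1 (P.subset hs hmem)
    exact ⟨s.max' hne, ⟨by omega, fun m hm => s.le_max' m (hpart ▸ hm)⟩, hpart⟩

theorem nodup_blockList (P : Finpartition (Finset.Icc 1 n)) : (blockList P).Nodup := by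
  refine List.Nodup.map_on ?_ ((List.Ico.nodup _ _).filter _)
  intro j hj k hk hjk
  simp only [List.mem_filter, List.Ico.mem, decide_eq_true_eq] at hj hk
  have hj' : j ∈ P.part j := P.mem_part_self.2 (Finset.mem_Icc.2 (by omega))
  have hk' : k ∈ P.part k := P.mem_part_self.2 (Finset.mem_Icc.2 (by omega))
  exact le_antisymm (hk.2 j (hjk ▸ hj')) (hj.2 k (hjk ▸ hk'))

theorem pairwise_blockList {P : Finpartition (Finset.Icc 1 n)} {r : Finset ℕ → Finset ℕ → Prop}
    (hP : (P.parts : Set (Finset ℕ)).Pairwise r) : (blockList P).Pairwise r :=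
  (nodup_blockList P).pairwise_of_forall_ne fun _ hs _ hu hne =>
    hP (mem_blockList.1 hs) (mem_blockList.1 hu) hne

theorem IsNonCrossing.nonCross {P : Finpartition (Finset.Icc 1 n)} (hP : IsNonCrossing P)
    {s u : Finset ℕ} (hs : s ∈ P.parts) (hu : u ∈ P.parts) (hne : s ≠ u) : NonCross s u :=
  (hP hs hu hne).nonCross (P.subset hs) (P.subset hu)

theorem part_eq_of_mem_part {P : Finpartition (Finset.Icc 1 n)} {i j : ℕ} (h : i ∈ P.part j) :
    P.part i = P.part j := by
  have hj : j ∈ Finset.Icc 1 n := by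
    rw [← P.part_nonempty]
    exact ⟨i, h⟩
  exact P.part_eq_of_mem (P.part_mem.2 hj) h

theorem mem_part_of_mem_part {P : Finpartition (Finset.Icc 1 n)} {i j : ℕ} (h : i ∈ P.part j) :
    i ∈ P.part i ∧ j ∈ P.part i ∧ j ∈ P.part j := by
  have hj : j ∈ Finset.Icc 1 n := by
    rw [← P.part_nonempty]
    exact ⟨i, h⟩
  have hi := P.part_subset j h
  rw [part_eq_of_mem_part h]
  exact ⟨h, P.mem_part_self.2 hj, P.mem_part_self.2 hj⟩

/-- `k` is the next smaller element of the block of `j`. -/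
def IsPred (P : Finpartition (Finset.Icc 1 n)) (k j : ℕ) : Prop :=
  k < j ∧ k ∈ P.part j ∧ ∀ m ∈ P.part j, m < j → m ≤ k

theorem exists_isPred {P : Finpartition (Finset.Icc 1 n)} {j : ℕ} (hj : HasBelow (P.part j) j) :
    ∃ k, IsPred P k j := by
  classical
  obtain ⟨i, hi, hij⟩ := hj
  have hne : ((P.part j).filter (· < j)).Nonempty := ⟨i, Finset.mem_filter.2 ⟨hi, hij⟩⟩
  have hmem := Finset.mem_filter.1 (((P.part j).filter (· < j)).max'_mem hne)
  exact ⟨_, hmem.2, hmem.1, fun m hm hmj => Finset.le_max' _ _ (Finset.mem_filter.2 ⟨hm, hmj⟩)⟩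

theorem exists_isPred_of_hasAbove {P : Finpartition (Finset.Icc 1 n)} {k : ℕ}
    (hk : HasAbove (P.part k) k) : ∃ j, IsPred P k j := by
  classical
  obtain ⟨i, hi, hki⟩ := hk
  have hne : ((P.part k).filter (k < ·)).Nonempty := ⟨i, Finset.mem_filter.2 ⟨hi, hki⟩⟩
  have hmem := Finset.mem_filter.1 (((P.part k).filter (k < ·)).min'_mem hne)
  refine ⟨_, hmem.2, (mem_part_of_mem_part hmem.1).2.1, fun m hm hmj => ?_⟩
  by_contra! hkm
  rw [part_eq_of_mem_part hmem.1] at hm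
  exact absurd (Finset.min'_le _ m (Finset.mem_filter.2 ⟨hm, hkm⟩)) (not_le.2 hmj)

/-- If the predecessor of `j` in `Q` were larger than the one in `P`, then its successor in `P`
would lie below `j` and have the same predecessor in `Q`. -/
theorem IsPred.not_lt {P Q : Finpartition (Finset.Icc 1 n)} (hP : IsNonCrossing P) {j k k' : ℕ}
    (hA : ∀ m, HasAbove (Q.part m) m → HasAbove (P.part m) m)
    (ih : ∀ m < j, ∀ i, IsPred P i m → IsPred Q i m) (hk : IsPred P k j) (hk' : IsPred Q k' j) :
    ¬ k < k' := by
  intro hlt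
  have hQ := part_eq_of_mem_part hk'.2.1
  have hab : HasAbove (Q.part k') k' := ⟨j, (mem_part_of_mem_part hk'.2.1).2.1, hk'.1⟩
  obtain ⟨m, hm⟩ := exists_isPred_of_hasAbove (hA k' hab)
  have hmk := mem_part_of_mem_part hm.2.1
  have hjk := mem_part_of_mem_part hk.2.1
  have hk'j : k' ∉ P.part j := fun h => absurd (hk.2.2 k' h hk'.1) (not_le.2 hlt)
  have hmj : m ∉ P.part j := fun h => hk'j (by
    rw [← part_eq_of_mem_part h]; exact hm.2.1)
  have hmj' : m < j := by
    by_contra! hjm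
    have hne : P.part j ≠ P.part m := fun h => hmj (h ▸ hmk.2.2)
    have hmne : j ≠ m := fun h => hne (h ▸ rfl)
    exact (hP.nonCross (P.part_mem.2 (P.part_subset _ hjk.2.2))
      (P.part_mem.2 (P.part_subset _ hmk.2.2)) hne).2.1 k hk.2.1 k' hm.2.1 j hjk.2.2 m hmk.2.2
      hlt hk'.1 (lt_of_le_of_ne hjm hmne)
  have hQm := ih m hmj' k' hm
  have hmQ : m ∈ Q.part j := by
    rw [← hQ]; exact (mem_part_of_mem_part hQm.2.1).2.1
  exact absurd (hk'.2.2 m hmQ hmj') (not_le.2 hQm.1)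

/-- Strong induction on `j`: the predecessors of smaller elements are known to agree. -/
theorem isPred_iff {P Q : Finpartition (Finset.Icc 1 n)} (hP : IsNonCrossing P)
    (hQ : IsNonCrossing Q) (hA : ∀ m, HasAbove (P.part m) m ↔ HasAbove (Q.part m) m)
    (hB : ∀ m, HasBelow (P.part m) m ↔ HasBelow (Q.part m) m) (j : ℕ) :
    ∀ k, IsPred P k j ↔ IsPred Q k j := by
  induction j using Nat.strong_induction_on with
  | _ j ih =>
    have key : ∀ k k', IsPred P k j → IsPred Q k' j → k = k' := fun k k' hk hk' =>
      le_antisymm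
        (not_lt.1 (hk'.not_lt hQ (fun m => (hA m).1) (fun m hm i => (ih m hm i).2) hk))
        (not_lt.1 (hk.not_lt hP (fun m => (hA m).2) (fun m hm i => (ih m hm i).1) hk'))
    intro k
    constructor <;> intro hk
    · obtain ⟨k', hk'⟩ := exists_isPred ((hB j).1 ⟨k, hk.2.1, hk.1⟩)
      rwa [key k k' hk hk']
    · obtain ⟨k', hk'⟩ := exists_isPred ((hB j).2 ⟨k, hk.2.1, hk.1⟩)
      rwa [← key k' k hk' hk]

theorem mem_part_of_isPred {P Q : Finpartition (Finset.Icc 1 n)}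
    (h : ∀ j k, IsPred P k j → IsPred Q k j) {i j : ℕ} (hij : i < j) (hi : i ∈ P.part j) :
    i ∈ Q.part j := by
  induction j using Nat.strong_induction_on with
  | _ j ih =>
    obtain ⟨k, hk⟩ := exists_isPred ⟨i, hi, hij⟩
    have hkQ := (h j k hk).2.1
    rcases (hk.2.2 i hi hij).eq_or_lt with rfl | hik
    · exact hkQ
    · rw [← part_eq_of_mem_part hkQ]
      refine ih k hk.1 hik ?_
      rwa [part_eq_of_mem_part hk.2.1]

theorem parts_subset_of_part_subset {P Q : Finpartition (Finset.Icc 1 n)}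
    (h : ∀ j, P.part j = Q.part j) : P.parts ⊆ Q.parts := by
  intro s hs
  obtain ⟨m, hm⟩ := P.nonempty_of_mem_parts hs
  rw [← P.part_eq_of_mem hs hm, h]
  exact Q.part_mem.2 (P.subset hs hm)

/-- A non-crossing partition is determined by the set of the elements that are not maximal in
their block and the set of the elements that are not minimal in their block. -/
theorem IsNonCrossing.eq_of_hasAbove_iff {P Q : Finpartition (Finset.Icc 1 n)}
    (hP : IsNonCrossing P) (hQ : IsNonCrossing Q)
    (hA : ∀ m, HasAbove (P.part m) m ↔ HasAbove (Q.part m) m)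
    (hB : ∀ m, HasBelow (P.part m) m ↔ HasBelow (Q.part m) m) : P = Q := by
  have hiff := isPred_iff hP hQ hA hB
  have hsub : ∀ {P Q : Finpartition (Finset.Icc 1 n)}, (∀ j k, IsPred P k j → IsPred Q k j) →
      ∀ j, P.part j ⊆ Q.part j := by
    intro P Q h j i hi
    rcases lt_trichotomy i j with hij | rfl | hij
    · exact mem_part_of_isPred h hij hi
    · exact Q.mem_part_self.2 (P.part_subset _ hi)
    · exact (mem_part_of_mem_part (mem_part_of_isPred h hij (mem_part_of_mem_part hi).2.1)).2.1
  have hpart : ∀ j, P.part j = Q.part j := fun j =>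
    (hsub (fun j k => (hiff j k).1) j).antisymm (hsub (fun j k => (hiff j k).2) j)
  exact Finpartition.ext ((parts_subset_of_part_subset hpart).antisymm
    (parts_subset_of_part_subset fun j => (hpart j).symm))

end Partitions

/-! ### Linear independence -/

section LinearIndependence

variable {n : ℕ}

/-- The images of the non-crossing partitions are linearly independent. The partition `Q` is tested
on the matrix entry whose row is the indicator of the elements of `{1, …, n}` that are not maximal
in their block, and whose column is the indicator of those that are not minimal. -/
theorem linearIndependent_of_hasTop {π : BraidGroup n →* Module.End ℂ StateFun}
    (hband : ∀ i j, 1 ≤ i → i < j → j ≤ n → ∃ c : (ℕ → Bool) → ℂ,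
      (∀ x, c x ≠ 0 ↔ x i = true ∧ x j = false) ∧
        HasTop n (π (band n j i)) (j - i) c (exch i j)) :
    LinearIndependent ℂ fun P : {P : Finpartition (Finset.Icc 1 n) // IsNonCrossing P} =>
      π (partitionElement n P.1) := by
  classical
  have htop : ∀ P : {P : Finpartition (Finset.Icc 1 n) // IsNonCrossing P}, ∃ d c f,
      HasTop n (π (partitionElement n P.1)) d c f ∧
      ∀ x, (c x ≠ 0 ↔ ∀ s ∈ P.1.parts, Fits s x) ∧
        (c x ≠ 0 → (∀ s ∈ P.1.parts, ShiftedOn s x (f x)) ∧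
          ∀ m, (∀ s ∈ P.1.parts, m ∉ s) → f x m = x m) := fun P => by
    have := exists_hasTop_prod hband (l := blockList P.1)
      (fun s hs => P.1.subset (mem_blockList.1 hs)) (pairwise_blockList P.1.disjoint)
    simpa only [partitionElement_eq, mem_blockList] using this
  choose d c f hT hcf using htop
  let row (P : {P : Finpartition (Finset.Icc 1 n) // IsNonCrossing P}) : ℕ → Bool :=
    fun m => decide (HasAbove (P.1.part m) m)
  let col (P : {P : Finpartition (Finset.Icc 1 n) // IsNonCrossing P}) : ℕ → Bool :=
    fun m => decide (HasBelow (P.1.part m) m)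
  let size (P : {P : Finpartition (Finset.Icc 1 n) // IsNonCrossing P}) : ℕ :=
    ((Finset.Icc 1 n).filter fun m => HasAbove (P.1.part m) m).card
  have hout : ∀ (P : Finpartition (Finset.Icc 1 n)) m, (m ∈ P.part m) ∨
      (∀ s ∈ P.parts, m ∉ s) ∧ ¬ HasAbove (P.part m) m ∧ ¬ HasBelow (P.part m) m := by
    intro P m
    by_cases hm : m ∈ Finset.Icc 1 n
    · exact Or.inl (P.mem_part_self.2 hm)
    · refine Or.inr ⟨fun s hs hms => hm (P.subset hs hms), ?_⟩
      rw [P.part_eq_empty.2 hm]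
      simp [HasAbove, HasBelow]
  have hfit : ∀ P x, c P x ≠ 0 → ∀ m, (HasAbove (P.1.part m) m → x m = true) := by
    intro P x hc m hab
    rcases hout P.1 m with hm | hm
    · exact (((hcf P x).1.1 hc) _ (P.1.part_mem.2 (P.1.part_subset _ hm)) m hm).1 hab
    · exact absurd hab hm.2.1
  have hshift : ∀ P x, c P x ≠ 0 → ∀ m, (HasBelow (P.1.part m) m → f P x m = true) ∧
      (HasAbove (P.1.part m) m → ¬ HasBelow (P.1.part m) m → f P x m = false) ∧
      (¬ HasAbove (P.1.part m) m → ¬ HasBelow (P.1.part m) m → f P x m = x m) := by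
    intro P x hc m
    obtain ⟨h1, h2⟩ := (hcf P x).2 hc
    rcases hout P.1 m with hm | hm
    · exact h1 _ (P.1.part_mem.2 (P.1.part_subset _ hm)) m hm
    · exact ⟨fun h => absurd h hm.2.2, fun h => absurd h hm.2.1, fun _ _ => h2 m hm.1⟩
  have hcrow : ∀ P, c P (row P) ≠ 0 := fun P => (hcf P _).1.2 fun s hs m hm => by
    have : P.1.part m = s := P.1.part_eq_of_mem hs hm
    simp only [row, this]
    exact ⟨fun h => by simpa using h, fun _ h => by simpa using h⟩
  have hfrow : ∀ P, f P (row P) = col P := fun P => by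
    funext m
    obtain ⟨h1, h2, h3⟩ := hshift P _ (hcrow P) m
    by_cases hb : HasBelow (P.1.part m) m
    · rw [h1 hb]; simp [col, hb]
    · by_cases ha : HasAbove (P.1.part m) m
      · rw [h2 ha hb]; simp [col, hb]
      · rw [h3 ha hb]; simp [row, col, hb, ha]
  -- a partition `P` that contributes to the test of `Q` in the top degree has size at most that
  -- of `Q`, with equality only for `P = Q`
  have hsub : ∀ P Q, c P (row Q) ≠ 0 → ∀ m, HasAbove (P.1.part m) m → HasAbove (Q.1.part m) m :=
    fun P Q hc m hab => by simpa [row] using hfit P _ hc m hab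
  have heq : ∀ P Q, c P (row Q) ≠ 0 → f P (row Q) = col Q → size Q ≤ size P → P = Q := by
    intro P Q hc hf hsize
    have hset : ((Finset.Icc 1 n).filter fun m => HasAbove (P.1.part m) m)
        = (Finset.Icc 1 n).filter fun m => HasAbove (Q.1.part m) m :=
      Finset.eq_of_subset_of_card_le (Finset.monotone_filter_right _ fun m _ => hsub P Q hc m) hsize
    have hA : ∀ m, HasAbove (P.1.part m) m ↔ HasAbove (Q.1.part m) m := by
      refine fun m => ⟨hsub P Q hc m, fun hab => ?_⟩
      have hm : m ∈ Finset.Icc 1 n := by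
        rcases hout Q.1 m with hm | hm
        · exact Q.1.part_subset _ hm
        · exact absurd hab hm.2.1
      have : m ∈ (Finset.Icc 1 n).filter fun m => HasAbove (Q.1.part m) m :=
        Finset.mem_filter.2 ⟨hm, hab⟩
      rw [← hset] at this
      exact (Finset.mem_filter.1 this).2
    refine Subtype.ext (P.2.eq_of_hasAbove_iff Q.2 hA fun m => ?_)
    obtain ⟨h1, h2, h3⟩ := hshift P _ hc m
    have hcol : f P (row Q) m = decide (HasBelow (Q.1.part m) m) := by rw [hf]
    rw [hcol] at h1 h2 h3
    constructor
    · intro h; simpa using h1 h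
    · intro h
      by_contra hb
      by_cases ha : HasAbove (P.1.part m) m
      · simpa [h] using h2 ha hb
      · have := h3 ha hb
        simp only [row, ← hA m, h, ha] at this
        simp at this
  rw [linearIndependent_iff']
  intro s g hg
  by_contra! hne
  -- among the partitions with non-zero coefficient, take one of maximal degree, and of minimal
  -- size among those
  obtain ⟨P₀, hP₀s, hP₀⟩ := hne
  obtain ⟨P₁, hP₁, hmax⟩ := Finset.exists_max_image (s.filter (g · ≠ 0)) d
    ⟨P₀, Finset.mem_filter.2 ⟨hP₀s, hP₀⟩⟩
  obtain ⟨Q, hQ, hmin⟩ := Finset.exists_min_image ((s.filter (g · ≠ 0)).filter (d · = d P₁)) size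
    ⟨P₁, Finset.mem_filter.2 ⟨hP₁, rfl⟩⟩
  rw [Finset.mem_filter] at hQ
  have hQs := Finset.mem_filter.1 hQ.1
  let φ : StateFun := Pi.single (col Q) 1
  have hdeg : degree n (col Q) = degree n (row Q) + d Q := by
    rw [← hfrow Q]; exact (hT Q).degree_eq _ (hcrow Q)
  have hval := congrFun (LinearMap.congr_fun hg φ) (row Q)
  rw [LinearMap.sum_apply, Finset.sum_apply, Finset.sum_eq_single Q] at hval
  · rw [LinearMap.smul_apply, Pi.smul_apply, (hT Q).apply_eq, hfrow] at hval
    · simp only [φ, Pi.single_eq_same, mul_one, smul_eq_mul, LinearMap.zero_apply,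
        Pi.zero_apply] at hval
      exact mul_ne_zero hQs.2 (hcrow Q) hval
    · intro y hy
      refine Pi.single_eq_of_ne (fun h => ?_) _
      rw [h] at hy
      omega
  · intro P hPs hPQ
    rw [LinearMap.smul_apply, Pi.smul_apply]
    by_cases hgP : g P = 0
    · rw [hgP, zero_smul]
    have hPmem : P ∈ s.filter (g · ≠ 0) := Finset.mem_filter.2 ⟨hPs, hgP⟩
    have hdP : d P ≤ d Q := by rw [hQ.2]; exact hmax P hPmem
    rw [(hT P).apply_eq]
    · by_cases hc : c P (row Q) = 0
      · rw [hc, zero_mul, smul_zero]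
      by_cases hf : f P (row Q) = col Q
      · have hdPQ : d P = d P₁ := by
          have := (hT P).degree_eq _ hc
          rw [hf, hdeg] at this
          rw [← hQ.2]; omega
        exact absurd (heq P Q hc hf (hmin P (Finset.mem_filter.2 ⟨hPmem, hdPQ⟩))) hPQ
      · rw [show φ (f P (row Q)) = 0 from Pi.single_eq_of_ne hf _, mul_zero, smul_zero]
    · intro y hy
      refine Pi.single_eq_of_ne (fun h => ?_) _
      rw [h] at hy
      omega
  · exact fun h => absurd hQs.1 h

theorem IsTLHom.comp {n : ℕ} {A B : Type*} [Ring A] [Algebra ℂ A] [Ring B] [Algebra ℂ B] {t : ℂ}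
    {π : BraidGroup n →* A} (hπ : IsTLHom t π) (ρ : A →ₐ[ℂ] B) :
    IsTLHom t ((ρ : A →* B).comp π) := by
  refine ⟨hπ.ne_zero, fun m h1 h2 => ?_, fun m h1 h2 => ?_⟩
  · simpa using congrArg ρ (hπ.quad m h1 h2)
  · have := congrArg ρ (hπ.flip m h1 h2)
    unfold FlipRel
    simpa using this

/-- The state representation detects the linear independence already in `TLₙ`. -/
theorem linearIndependent_partitionElement (n : ℕ) (τ t : ℂ) (hτ : τ ≠ 0) (ht : t ≠ 0)
    (hτt : τ⁻¹ = 2 + t + t⁻¹) :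
    LinearIndependent ℂ fun P : {P : Finpartition (Finset.Icc 1 n) // IsNonCrossing P} =>
      braidToTL n τ t hτ ht hτt (partitionElement n P.1) := by
  have key := sq_mul_tau hτ ht hτt
  have ht1 : t + 1 ≠ 0 := fun h0 => ht (by rw [← key, h0]; ring)
  have hπ := (isTLHom_braidToTL n τ t hτ ht hτt).comp (stateRep n key ht1)
  have hσ : ∀ m, 1 ≤ m → m < n → ((stateRep n key ht1 : TL n τ →* Module.End ℂ StateFun).comp
      (braidToTL n τ t hτ ht hτt)) (sigma n m) = (t + 1) • tlGen t m - 1 := fun m h1 h2 => by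
    have hm := braidToTL_sigma n τ t hτ ht hτt ⟨m, h1, h2⟩
    have he := stateRep_e n key ht1 ⟨m, h1, h2⟩
    rw [MonoidHom.comp_apply, hm, MonoidHom.coe_coe, h, map_sub, map_smul, map_one, he]
  have hli := linearIndependent_of_hasTop fun i j hi hij hj =>
    exists_hasTop_band hπ hσ ht1 hi hij hj
  exact LinearIndependent.of_comp (stateRep n key ht1).toLinearMap hli

end LinearIndependence

/-! ### Simple elements and non-crossing partitions -/

/-- Adding singletons to a family of pairwise non-crossing sets yields a non-crossing partition. -/
theorem exists_finpartition {n : ℕ} {l : List (Finset ℕ)}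
    (hl : ∀ s ∈ l, s.Nonempty ∧ s ⊆ Finset.Icc 1 n) (hp : l.Pairwise NonCross) :
    ∃ P : Finpartition (Finset.Icc 1 n), IsNonCrossing P ∧ (∀ s ∈ l, s ∈ P.parts) ∧
      ∀ s ∈ P.parts, s ∈ l ∨ ∃ k, s = {k} := by
  classical
  have : Std.Symm NonCross := ⟨fun _ _ h => h.symm⟩
  have hpw := hp.forall
  let sing : Finset (Finset ℕ) :=
    ((Finset.Icc 1 n).filter fun k => ∀ s ∈ l, k ∉ s).image fun k => {k}
  have hsing : ∀ s, s ∈ sing ↔ ∃ k ∈ Finset.Icc 1 n, (∀ u ∈ l, k ∉ u) ∧ {k} = s := fun s => by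
    simp only [sing, Finset.mem_image, Finset.mem_filter, and_assoc]
  have hmem : ∀ s, s ∈ l.toFinset ∪ sing ↔ s ∈ l ∨ s ∈ sing := fun s => by simp
  have hne : ∀ s ∈ l.toFinset ∪ sing, s.Nonempty ∧ s ⊆ Finset.Icc 1 n := by
    intro s hs
    rcases (hmem s).1 hs with hs | hs
    · exact hl s hs
    · obtain ⟨k, hk, -, rfl⟩ := (hsing s).1 hs
      exact ⟨Finset.singleton_nonempty k, Finset.singleton_subset_iff.2 hk⟩
  have hnc : ∀ s ∈ l.toFinset ∪ sing, ∀ u ∈ l.toFinset ∪ sing, s ≠ u → NonCross s u := by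
    intro s hs u hu hsu
    rcases (hmem s).1 hs with hs | hs
    · rcases (hmem u).1 hu with hu | hu
      · exact hpw hs hu hsu
      · obtain ⟨k, -, hk, rfl⟩ := (hsing u).1 hu
        exact (nonCross_singleton (hk s hs)).symm
    · obtain ⟨k, -, hk, rfl⟩ := (hsing s).1 hs
      refine nonCross_singleton fun hku => ?_
      rcases (hmem u).1 hu with hu | hu
      · exact hk u hu hku
      · obtain ⟨j, -, -, rfl⟩ := (hsing u).1 hu
        exact hsu (by rw [Finset.mem_singleton.1 hku])
  have huniq : ∀ a ∈ Finset.Icc 1 n, ∃! s ∈ l.toFinset ∪ sing, a ∈ s := by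
    intro a ha
    have hex : ∃ s ∈ l.toFinset ∪ sing, a ∈ s := by
      by_cases h : ∃ s ∈ l, a ∈ s
      · obtain ⟨s, hs, has⟩ := h
        exact ⟨s, (hmem s).2 (Or.inl hs), has⟩
      · push Not at h
        exact ⟨{a}, (hmem _).2 (Or.inr ((hsing _).2 ⟨a, ha, h, rfl⟩)), Finset.mem_singleton_self a⟩
    obtain ⟨s, hs, has⟩ := hex
    refine ⟨s, ⟨hs, has⟩, fun u hu => ?_⟩
    by_contra hus
    exact Finset.disjoint_left.1 (hnc u hu.1 s hs hus).1 hu.2 has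
  refine ⟨Finpartition.ofExistsUnique (l.toFinset ∪ sing) (fun s hs => (hne s hs).2) huniq
    fun h => (hne ∅ h).1.ne_empty rfl, ?_, fun s hs => ?_, fun s hs => ?_⟩
  · intro s hs u hu hsu
    exact (hnc s hs u hu hsu).parallel (hne s hs).1 (hne u hu).1 (hne s hs).2 (hne u hu).2
  · exact (hmem s).2 (Or.inl hs)
  · rcases (hmem s).1 hs with hs | hs
    · exact Or.inl hs
    · obtain ⟨k, -, -, rfl⟩ := (hsing s).1 hs
      exact Or.inr ⟨k, rfl⟩

/-- Only the sets with at least two elements contribute to a product of descending cycles. -/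
theorem prod_descCycle_filter (n : ℕ) (l : List (Finset ℕ)) :
    ((l.filter fun s => 2 ≤ s.card).map (descCycle n)).prod = (l.map (descCycle n)).prod := by
  rw [← prod_map_ite_one]
  congr 1
  refine List.map_congr_left fun s _ => ?_
  split_ifs with hs
  · rfl
  · rcases s.eq_empty_or_nonempty with rfl | hne
    · simp [descCycle, cycleProd]
    · obtain ⟨k, rfl⟩ := Finset.card_eq_one.1 (le_antisymm (by omega) hne.card_pos)
      exact (descCycle_singleton n k).symm

theorem partitionElement_mem {n : ℕ} {P : Finpartition (Finset.Icc 1 n)} (hP : IsNonCrossing P) :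
    partitionElement n P ∈ simpleElements n :=
  ⟨blockList P, fun _ hs => ⟨P.nonempty_of_mem_parts (mem_blockList.1 hs),
    P.subset (mem_blockList.1 hs)⟩, pairwise_blockList hP, partitionElement_eq P⟩

theorem exists_partitionElement_eq {n : ℕ} {g : BraidGroup n} (hg : g ∈ simpleElements n) :
    ∃ P : Finpartition (Finset.Icc 1 n), IsNonCrossing P ∧ partitionElement n P = g := by
  rw [← simpleSet_eq_simpleElements] at hg
  obtain ⟨l, hl, hp, rfl⟩ := hg
  obtain ⟨P, hP, hlP, hPl⟩ := exists_finpartition hl hp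
  refine ⟨P, hP, ?_⟩
  have hnd : l.Nodup := hp.imp_of_mem fun {s u} hs _ hsu heq => by
    obtain ⟨k, hk⟩ := (hl s hs).1
    exact Finset.disjoint_left.1 hsu.1 hk (heq ▸ hk)
  rw [partitionElement_eq, ← prod_descCycle_filter n (blockList P), ← prod_descCycle_filter n l]
  have hperm : ((blockList P).filter fun s => 2 ≤ s.card).Perm (l.filter fun s => 2 ≤ s.card) := by
    refine (List.perm_ext_iff_of_nodup ((nodup_blockList P).filter _) (hnd.filter _)).2 fun s => ?_
    simp only [List.mem_filter, mem_blockList, decide_eq_true_eq]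
    refine and_congr_left fun hs => ⟨fun h => ?_, hlP s⟩
    rcases hPl s h with h | ⟨k, rfl⟩
    · exact h
    · simp at hs
  refine (hperm.map _).prod_eq' (pairwise_commute (fun s hs => ?_) ?_)
  · exact P.subset (mem_blockList.1 (List.mem_of_mem_filter hs))
  · exact (pairwise_blockList fun s hs u hu hne => hP.nonCross hs hu hne).filter _

end Zinno

end

theorem theorem1p1 (n : ℕ) (τ t : ℂ) (hτ : τ ≠ 0) (ht : t ≠ 0) (hτt : τ⁻¹ = 2 + t + t⁻¹) :
    Set.BijOn (Zinno.partitionElement n)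
      {P : Finpartition (Finset.Icc 1 n) | Zinno.IsNonCrossing P} (Zinno.simpleElements n) ∧
    ∃ b : Module.Basis (Zinno.simpleElements n) ℂ (Zinno.TL n τ),
      ∀ s : Zinno.simpleElements n,
        b s = Zinno.braidToTL n τ t hτ ht hτt (s : Zinno.BraidGroup n) := by
  have hli := Zinno.linearIndependent_partitionElement n τ t hτ ht hτt
  have hbij : Set.BijOn (Zinno.partitionElement n)
      {P : Finpartition (Finset.Icc 1 n) | Zinno.IsNonCrossing P} (Zinno.simpleElements n) := by
    refine ⟨fun P hP => Zinno.partitionElement_mem hP, fun P hP Q hQ hPQ => ?_,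
      fun g hg => Zinno.exists_partitionElement_eq hg⟩
    have := hli.injective (a₁ := ⟨P, hP⟩) (a₂ := ⟨Q, hQ⟩) (by simp only [hPQ])
    exact congrArg Subtype.val this
  refine ⟨hbij, ?_⟩
  have hli' : LinearIndependent ℂ fun s : Zinno.simpleElements n =>
      Zinno.braidToTL n τ t hτ ht hτt (s : Zinno.BraidGroup n) :=
    (linearIndependent_equiv (Set.BijOn.equiv _ hbij)).1 hli
  refine ⟨Module.Basis.mk hli' ?_, fun s => Module.Basis.mk_apply hli' _ s⟩
  rw [← Set.image_eq_range, Zinno.span_simpleElements]
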